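/- A \emph{spherical bigon} with angles $(\pi\vartheta_1,\pi\vartheta_2)$ is a closed disc with two marked boundary points $x_1,x_2$ (the vertices), endowed with a Riemannian metric $g$ of constant curvature $1$, smooth up to the boundary away from the vertices, such that the two boundary arcs (the sides) between $x_1$ and $x_2$ are geodesic, and such that near $x_i$ the metric is isometric to a neighbourhood of the tip of the sector $\{(\rho,\psi): \rho\ge 0,\ 0\le\psi\le\pi\vartheta_i\}$ with metric $d\rho^2+\sin^2\!\rho\,d\psi^2$. A family $(g_s)_{s\in S}$ of such metrics on the disc with fixed vertices is \emph{continuous} if for all $s\in S$ and $\varepsilon>0$ one has $(1-\varepsilon)g_s\le g_{t}\le(1+\varepsilon)g_s$ on the whole disc minus the vertices for every $t\in S$ close enough to $s$. A spherical bigon with metric $g$ and angles $(\pi\alpha,\pi\alpha)$ is \emph{angle-deformable} if there are a neighbourhood $N\subset\mathbb{R}^2$ of $(\alpha,\alpha)$ and a continuous family of spherical bigon metrics $g_\nu$ with angles $(\pi\nu_1,\pi\nu_2)$, indexed by the $\nu\in N$ with $\nu_1=\nu_2$, such that $g_{(\alpha,\alpha)}=g$. (The two angles of a spherical bigon are always equal,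 so no other $\nu$ can occur.) \textbf{Lemma (Existence of bigons).} (a) For every real $\alpha>0$ there exists an angle-deformable spherical bigon $B_\alpha$ with both angles equal to $\pi\alpha$ and with its two vertices at distance $\pi$ from each other. (b) For every integer $d>0$ there exists a continuous family of spherical bigons $(0,2\pi)\ni\ell\mapsto B(d,\ell)$ with both angles equal to $d\pi$, whose two sides have lengths $(\ell,2\pi-\ell)$ if $d$ is odd and $(\ell,\ell)$ if $d$ is even. -/

import Mathlib

open scoped ContDiff Topology

noncomputable section

namespace SphericalBigon

/-- A field of real bilinear forms on the plane `ℂ = ℝ²`. Only its values on the closed unit disc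
without the two vertices are used. -/
abbrev Tensor : Type := ℂ → ℂ →L[ℝ] ℂ →L[ℝ] ℝ

/-- The underlying surface of a bigon is the closed unit disc, with the two vertices `1` and `-1` on
its boundary. This is the closed disc without the vertices. -/
def puncturedDisc : Set ℂ := Metric.closedBall 0 1 \ {1, -1}

/-- Near `p` the metric `g` is isometric to the round unit sphere `S²`: some neighbourhood of `p` in
the punctured disc admits a smooth map to `S² ⊆ ℝ³` that pulls the round metric back to `g` and
sends the boundary of the disc into a great circle. (At an interior point the last
requirement is void on small neighbourhoods; at a boundary point it says that the boundary is a
geodesic there.) -/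
def IsLocallySphericalAt (g : Tensor) (p : ℂ) : Prop :=
  ∃ U : Set ℂ, IsOpen U ∧ p ∈ U ∧ ∃ f : ℂ → EuclideanSpace ℝ (Fin 3),
    ContDiffOn ℝ ∞ f (U ∩ puncturedDisc) ∧
    (∀ z ∈ U ∩ puncturedDisc, ‖f z‖ = 1) ∧
    (∀ z ∈ U ∩ puncturedDisc, ∀ v w : ℂ,
      inner ℝ (fderivWithin ℝ f (U ∩ puncturedDisc) z v)
        (fderivWithin ℝ f (U ∩ puncturedDisc) z w) = g z v w) ∧
    ∃ n : EuclideanSpace ℝ (Fin 3), ‖n‖ = 1 ∧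
      ∀ z ∈ U ∩ puncturedDisc, ‖z‖ = 1 → inner ℝ n (f z) = 0

/-- The inner angle of `g` at the vertex `x` is `π θ`: a punctured neighbourhood of `x` is isometric
to the standard punctured sector of angle `π θ` and some radius `r`, that is, to
`{(ρ, ψ) | 0 < ρ < r, 0 ≤ ψ ≤ π θ}` with the metric `dρ² + sin² ρ dψ²`, and `x` corresponds to the
tip `ρ = 0`. -/
def HasInnerAngle (g : Tensor) (x : ℂ) (θ : ℝ) : Prop :=
  0 < θ ∧ ∃ r : ℝ, 0 < r ∧ r < Real.pi ∧ ∃ U : Set ℂ, IsOpen U ∧ x ∈ U ∧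
    ∃ (Φ : ℂ → ℝ × ℝ) (Ψ : ℝ × ℝ → ℂ),
      ContDiffOn ℝ ∞ Φ (U ∩ puncturedDisc) ∧
      ContDiffOn ℝ ∞ Ψ (Set.Ioo 0 r ×ˢ Set.Icc 0 (Real.pi * θ)) ∧
      Set.MapsTo Φ (U ∩ puncturedDisc) (Set.Ioo 0 r ×ˢ Set.Icc 0 (Real.pi * θ)) ∧
      Set.MapsTo Ψ (Set.Ioo 0 r ×ˢ Set.Icc 0 (Real.pi * θ)) (U ∩ puncturedDisc) ∧
      Set.InvOn Ψ Φ (U ∩ puncturedDisc) (Set.Ioo 0 r ×ˢ Set.Icc 0 (Real.pi * θ)) ∧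
      (∀ z ∈ U ∩ puncturedDisc, ∀ v w : ℂ,
        g z v w =
          (fderivWithin ℝ Φ (U ∩ puncturedDisc) z v).1 *
              (fderivWithin ℝ Φ (U ∩ puncturedDisc) z w).1 +
            Real.sin (Φ z).1 ^ 2 *
              ((fderivWithin ℝ Φ (U ∩ puncturedDisc) z v).2 *
                (fderivWithin ℝ Φ (U ∩ puncturedDisc) z w).2)) ∧
      Filter.Tendsto (fun z => (Φ z).1) (𝓝[U ∩ puncturedDisc] x) (𝓝 0)

/-- `g` is a spherical metric on the bigon with inner angles `π θ₁` at the vertex `1` and `π θ₂` at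
the vertex `-1`: a Riemannian metric of constant curvature `1`, smooth up to the boundary away from
the vertices, for which the two boundary arcs are geodesic. -/
structure IsSphericalBigon (g : Tensor) (θ₁ θ₂ : ℝ) : Prop where
  smooth : ContDiffOn ℝ ∞ g puncturedDisc
  symm : ∀ z ∈ puncturedDisc, ∀ v w : ℂ, g z v w = g z w v
  pos : ∀ z ∈ puncturedDisc, ∀ v : ℂ, v ≠ 0 → 0 < g z v v
  spherical : ∀ p ∈ puncturedDisc, IsLocallySphericalAt g p
  angle_one : HasInnerAngle g 1 θ₁
  angle_neg_one : HasInnerAngle g (-1) θ₂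

/-- The `g`-length of the plane curve `γ` over the open interval `(a, b)`. -/
def curveLength (g : Tensor) (γ : ℝ → ℂ) (a b : ℝ) : ENNReal :=
  ∫⁻ t in Set.Ioo a b, ENNReal.ofReal (Real.sqrt (g (γ t) (deriv γ t) (deriv γ t)))

/-- The length of the edge of the bigon on the upper half of the unit circle. -/
def upperEdgeLength (g : Tensor) : ENNReal :=
  curveLength g (fun t => Complex.exp (t * Complex.I)) 0 Real.pi

/-- The length of the edge of the bigon on the lower half of the unit circle. -/
def lowerEdgeLength (g : Tensor) : ENNReal :=
  curveLength g (fun t => Complex.exp (t * Complex.I)) Real.pi (2 * Real.pi)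

/-- The distance between the two vertices: the infimum of the lengths of curves in the disc that
join them (curves that meet the vertices at the end points only). -/
def vertexDist (g : Tensor) : ENNReal :=
  ⨅ γ ∈ {γ : ℝ → ℂ | ContinuousOn γ (Set.Icc 0 1) ∧ ContDiffOn ℝ 1 γ (Set.Ioo 0 1) ∧
    γ 0 = 1 ∧ γ 1 = -1 ∧ ∀ t ∈ Set.Ioo (0 : ℝ) 1, γ t ∈ puncturedDisc}, curveLength g γ 0 1

/-- The family `G` of metrics is continuous on the parameter set `S`, in the Lipschitz sense: nearby
metrics of the family differ, uniformly on the whole bigon, by factors close to `1`. (In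
particular the coefficients of the metrics depend continuously on the parameter, and so do
distances and lengths.) -/
def IsContinuousFamilyOn {ι : Type*} [TopologicalSpace ι] (S : Set ι) (G : ι → Tensor) : Prop :=
  ∀ i ∈ S, ∀ ε > (0 : ℝ), ∀ᶠ j in 𝓝[S] i, ∀ z ∈ puncturedDisc, ∀ v : ℂ,
    (1 - ε) * G i z v v ≤ G j z v v ∧ G j z v v ≤ (1 + ε) * G i z v v

/-- The metric `g` of a spherical bigon with angles `π θ.1`, `π θ.2` is angle-deformable: it belongs
to a continuous family of spherical metrics `G ν` on the bigon with angles `π ν.1`, `π ν.2`, where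
`ν` runs through the pairs of angles of bigons in a neighbourhood `N` of `θ`. The two angles of a
spherical bigon are always equal, so these are the pairs in `N` with `ν.1 = ν.2`. -/
def IsAngleDeformable (g : Tensor) (θ : ℝ × ℝ) : Prop :=
  ∃ N ∈ 𝓝 θ, ∃ G : ℝ × ℝ → Tensor,
    IsContinuousFamilyOn (N ∩ {ν | ν.1 = ν.2}) G ∧
    (∀ ν ∈ N ∩ {ν | ν.1 = ν.2}, IsSphericalBigon (G ν) ν.1 ν.2) ∧
    Set.EqOn (G θ) g puncturedDisc

end SphericalBigon

end

/-! With `w = log ((1 + z) / (1 - z))`, put `s = Re w` and `ψ = α (π / 2 - Im w)`. The vertices `1`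
and `-1` lie at `s = +∞` and `s = -∞`, and the edges are `ψ = 0` and `ψ = π α`. Every bigon needed
is one of the metrics `sin² β (ds² + dψ²) / (cosh s + cos β cos ψ)²`.

For `ζ = exp (-s + iψ)` this is, up to a rotation, the round metric in the stereographic coordinate
`sin β · ζ / (1 + cos β · ζ)`. The Möbius map fixes `ζ = 0` and brings `ζ = ∞` to the end of a great
circle arc of length `2 β`, the image of `ψ = 0`. Hence the curvature is `1`
(`inner_fderiv_developingMap`) and the upper edge is geodesic. The lower edge is geodesic as soon as
`cos β sin (π α) = 0`, which leaves two useful cases.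

For (a), take `β = π / 2` and any `α`: this is the lune `dρ² + sin² ρ dψ²` with `ρ = 2 arctan (exp
(-s))`. The function `ρ` is 1-Lipschitz and runs from `0` to `π`, so the vertices are at distance
`π`. For (b), take `α = d` and `β = ℓ / 2`: both edges lie over one great circle, and `cos (π d) =
±1` decides whether the lower edge has length `2π - ℓ` or `ℓ`.

The angle `α` only stretches the direction `Im w`. The conformal model `ζ = exp (-α w)` would give
factors `α / cosh (α s)`, whose ratios for different `α` are unbounded at the vertices; here the
metrics of a family remain uniformly comparable.

At the vertex `1`, polar coordinates are read off from `log` of the Möbius map, lifted so that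
angles beyond `2π` cause no trouble (`logMobius`, `bigonMetric_eq_polar`). A reflection carries them
to `-1`. -/

noncomputable section

namespace SphericalBigon

/-! ### The strip coordinate and the metrics -/

/-- The complement of the real rays `(-∞, -1]` and `[1, ∞)`, on which the strip coordinate
`log ((1 + z) / (1 - z))` is holomorphic. -/
def coordDomain : Set ℂ := {z | z ≠ 1 ∧ (1 + z) / (1 - z) ∈ Complex.slitPlane}

/-- The coordinate that maps the disc without its vertices onto the strip `|Im w| ≤ π / 2`. -/
def stripCoord (z : ℂ) : ℂ := Complex.log ((1 + z) / (1 - z))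

/-- The differential of the real part of `stripCoord`. -/
def dRe (z : ℂ) : ℂ →L[ℝ] ℝ := Complex.reCLM ∘L ContinuousLinearMap.mul ℝ ℂ (2 / (1 - z ^ 2))

/-- The differential of the imaginary part of `stripCoord`. -/
def dIm (z : ℂ) : ℂ →L[ℝ] ℝ := Complex.imCLM ∘L ContinuousLinearMap.mul ℝ ℂ (2 / (1 - z ^ 2))

lemma dRe_apply (z v : ℂ) : dRe z v = (2 / (1 - z ^ 2) * v).re := rfl

lemma dIm_apply (z v : ℂ) : dIm z v = (2 / (1 - z ^ 2) * v).im := rfl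

/-- The angular coordinate of the lune of angle `π α`; it vanishes on the upper edge. -/
def lunePhase (α : ℝ) (z : ℂ) : ℝ := α * (Real.pi / 2 - (stripCoord z).im)

/-- The metric of the bigon with angles `π α` whose upper edge has length `2 β`. -/
def bigonMetric (α β : ℝ) : Tensor := fun z =>
  ((Real.sin β / (Real.cosh (stripCoord z).re + Real.cos β * Real.cos (lunePhase α z))) ^ 2 •
      dRe z).smulRight (dRe z) +
    (((Real.sin β / (Real.cosh (stripCoord z).re + Real.cos β * Real.cos (lunePhase α z))) ^ 2 *
      α ^ 2) • dIm z).smulRight (dIm z)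

lemma bigonMetric_apply (α β : ℝ) (z v w : ℂ) : bigonMetric α β z v w =
    (Real.sin β / (Real.cosh (stripCoord z).re + Real.cos β * Real.cos (lunePhase α z))) ^ 2 *
      (dRe z v * dRe z w + α ^ 2 * (dIm z v * dIm z w)) := by
  simp only [bigonMetric, FunLike.coe_add, FunLike.coe_smul, Pi.add_apply, Pi.smul_apply,
    ContinuousLinearMap.smulRight_apply, smul_eq_mul]
  ring

lemma continuousAt_cayley {z : ℂ} (hz : z ≠ 1) : ContinuousAt (fun z : ℂ => (1 + z) / (1 - z)) z :=
  ContinuousAt.div (by fun_prop) (by fun_prop) (sub_ne_zero.2 hz.symm)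

lemma isOpen_coordDomain : IsOpen coordDomain := by
  rw [isOpen_iff_mem_nhds]
  rintro z ⟨h1, h2⟩
  filter_upwards [isOpen_ne.mem_nhds h1,
    (continuousAt_cayley h1).preimage_mem_nhds (Complex.isOpen_slitPlane.mem_nhds h2)] with y a b
  exact ⟨a, b⟩

lemma mem_puncturedDisc {z : ℂ} : z ∈ puncturedDisc ↔ ‖z‖ ≤ 1 ∧ z ≠ 1 ∧ z ≠ -1 := by
  simp [puncturedDisc]

lemma re_cayley (z : ℂ) :
    ((1 + z) / (1 - z)).re = (1 - ‖z‖ ^ 2) / Complex.normSq (1 - z) := by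
  rw [Complex.div_re, ← add_div, ← Complex.normSq_eq_norm_sq, Complex.normSq_apply z]
  congr 1
  simp
  ring

lemma im_cayley (z : ℂ) : ((1 + z) / (1 - z)).im = 2 * z.im / Complex.normSq (1 - z) := by
  rw [Complex.div_im, ← sub_div]
  congr 1
  simp
  ring

lemma re_cayley_nonneg {z : ℂ} (hz : ‖z‖ ≤ 1) : 0 ≤ ((1 + z) / (1 - z)).re := by
  rw [re_cayley]
  exact div_nonneg (by nlinarith [norm_nonneg z]) (Complex.normSq_nonneg _)

lemma cayley_ne_zero {z : ℂ} (h1 : z ≠ 1) (h2 : z ≠ -1) : (1 + z) / (1 - z) ≠ 0 :=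
  div_ne_zero (fun h => h2 (by linear_combination h)) (sub_ne_zero.2 h1.symm)

lemma puncturedDisc_subset_coordDomain : puncturedDisc ⊆ coordDomain := by
  intro z hz
  obtain ⟨h, h1, h2⟩ := mem_puncturedDisc.1 hz
  refine ⟨h1, ?_⟩
  rw [Complex.mem_slitPlane_iff]
  by_contra! hc
  exact cayley_ne_zero h1 h2 (Complex.ext (le_antisymm hc.1 (re_cayley_nonneg h)) hc.2)

lemma ne_neg_one_of_mem_coordDomain {z : ℂ} (hz : z ∈ coordDomain) : z ≠ -1 := by
  rintro rfl
  simpa using Complex.slitPlane_ne_zero hz.2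

lemma exp_stripCoord {z : ℂ} (hz : z ∈ coordDomain) :
    Complex.exp (stripCoord z) = (1 + z) / (1 - z) :=
  Complex.exp_log (Complex.slitPlane_ne_zero hz.2)

lemma one_sub_sq_ne_zero {z : ℂ} (hz : z ∈ coordDomain) : 1 - z ^ 2 ≠ 0 := by
  have h : (1 - z) * (1 + z) ≠ 0 := mul_ne_zero (sub_ne_zero.2 hz.1.symm)
    (fun h => ne_neg_one_of_mem_coordDomain hz (by linear_combination h))
  intro h'
  exact h (by linear_combination h')

lemma hasDerivAt_stripCoord {z : ℂ} (hz : z ∈ coordDomain) :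
    HasDerivAt stripCoord (2 / (1 - z ^ 2)) z := by
  have h1 : (1 : ℂ) - z ≠ 0 := sub_ne_zero.2 hz.1.symm
  have h2 : (1 : ℂ) + z ≠ 0 :=
    fun h => ne_neg_one_of_mem_coordDomain hz (by linear_combination h)
  have h3 := one_sub_sq_ne_zero hz
  have h : HasDerivAt (fun z : ℂ => (1 + z) / (1 - z)) (2 / (1 - z) ^ 2) z := by
    refine (((hasDerivAt_id' z).const_add (1 : ℂ)).fun_div ((hasDerivAt_id' z).const_sub 1)
      h1).congr_deriv ?_
    ring
  refine (h.clog hz.2).congr_deriv ?_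
  field_simp
  ring

lemma hasFDerivAt_re_stripCoord {z : ℂ} (hz : z ∈ coordDomain) :
    HasFDerivAt (fun z => (stripCoord z).re) (dRe z) z := by
  refine (Complex.reCLM.hasFDerivAt.comp z
    ((hasDerivAt_stripCoord hz).hasFDerivAt.restrictScalars ℝ)).congr_fderiv ?_
  ext
  simp [mul_comm, dRe_apply]

lemma hasFDerivAt_im_stripCoord {z : ℂ} (hz : z ∈ coordDomain) :
    HasFDerivAt (fun z => (stripCoord z).im) (dIm z) z := by
  refine (Complex.imCLM.hasFDerivAt.comp z
    ((hasDerivAt_stripCoord hz).hasFDerivAt.restrictScalars ℝ)).congr_fderiv ?_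
  ext
  simp [mul_comm, dIm_apply]

lemma hasFDerivAt_lunePhase (α : ℝ) {z : ℂ} (hz : z ∈ coordDomain) :
    HasFDerivAt (lunePhase α) (-α • dIm z) z := by
  refine (((hasFDerivAt_im_stripCoord hz).const_sub (Real.pi / 2)).const_mul α).congr_fderiv ?_
  module

lemma contDiffOn_stripCoord : ContDiffOn ℝ ∞ stripCoord coordDomain := by
  intro z hz
  have h : AnalyticAt ℂ stripCoord z :=
    (DifferentiableOn.analyticAt (fun y hy => (hasDerivAt_stripCoord hy).differentiableAt
      |>.differentiableWithinAt) (isOpen_coordDomain.mem_nhds hz))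
  exact (h.contDiffAt.restrict_scalars ℝ).contDiffWithinAt

lemma contDiffOn_re_stripCoord : ContDiffOn ℝ ∞ (fun z => (stripCoord z).re) coordDomain :=
  Complex.reCLM.contDiff.comp_contDiffOn contDiffOn_stripCoord

lemma contDiffOn_im_stripCoord : ContDiffOn ℝ ∞ (fun z => (stripCoord z).im) coordDomain :=
  Complex.imCLM.contDiff.comp_contDiffOn contDiffOn_stripCoord

lemma contDiffOn_lunePhase (α : ℝ) : ContDiffOn ℝ ∞ (lunePhase α) coordDomain :=
  contDiffOn_const.mul (contDiffOn_const.sub contDiffOn_im_stripCoord)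

lemma contDiffOn_deriv_stripCoord :
    ContDiffOn ℝ ∞ (fun z : ℂ => 2 / (1 - z ^ 2)) coordDomain := by
  simp only [div_eq_mul_inv]
  exact contDiffOn_const.mul (ContDiffOn.inv (by fun_prop) fun z hz => one_sub_sq_ne_zero hz)

lemma contDiffOn_dRe : ContDiffOn ℝ ∞ dRe coordDomain :=
  contDiffOn_const.clm_comp ((ContinuousLinearMap.mul ℝ ℂ).contDiff.comp_contDiffOn
    contDiffOn_deriv_stripCoord)

lemma contDiffOn_dIm : ContDiffOn ℝ ∞ dIm coordDomain :=
  contDiffOn_const.clm_comp ((ContinuousLinearMap.mul ℝ ℂ).contDiff.comp_contDiffOn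
    contDiffOn_deriv_stripCoord)

lemma abs_cos_lt_one {β : ℝ} (hβ : β ∈ Set.Ioo 0 Real.pi) : |Real.cos β| < 1 := by
  rw [← sq_lt_one_iff_abs_lt_one]
  nlinarith [Real.sin_sq_add_cos_sq β, Real.sin_pos_of_mem_Ioo hβ]

/-- Besides positivity, this bound gives the uniformity over the disc needed for continuity in `β`:
it does not involve `s` and `y`. -/
lemma one_sub_abs_le_conformalDenom (c s y : ℝ) :
    1 - |c| ≤ Real.cosh s + c * Real.cos y := by
  have h : |c * Real.cos y| ≤ |c| := by
    rw [abs_mul]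
    exact mul_le_of_le_one_right (abs_nonneg _) (Real.abs_cos_le_one y)
  linarith [Real.one_le_cosh s, (abs_le.1 h).1]

lemma conformalDenom_pos {β : ℝ} (hβ : β ∈ Set.Ioo 0 Real.pi) (s y : ℝ) :
    0 < Real.cosh s + Real.cos β * Real.cos y := by
  linarith [one_sub_abs_le_conformalDenom (Real.cos β) s y, abs_cos_lt_one hβ]

lemma contDiffOn_bigonMetric (α : ℝ) {β : ℝ} (hβ : β ∈ Set.Ioo 0 Real.pi) :
    ContDiffOn ℝ ∞ (bigonMetric α β) coordDomain := by
  have h := ContDiffOn.pow (ContDiffOn.div (contDiffOn_const (c := Real.sin β))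
    (contDiffOn_re_stripCoord.cosh.add (contDiffOn_const.mul (contDiffOn_lunePhase α).cos))
      fun z _ => (conformalDenom_pos hβ _ _).ne') 2
  exact ((h.smul contDiffOn_dRe).smulRight contDiffOn_dRe).add
    (((h.mul (contDiffOn_const (c := α ^ 2))).smul contDiffOn_dIm).smulRight contDiffOn_dIm)

lemma bigonMetric_pos {α β : ℝ} (hα : 0 < α) (hβ : β ∈ Set.Ioo 0 Real.pi) {z : ℂ}
    (hz : z ∈ coordDomain) {v : ℂ} (hv : v ≠ 0) : 0 < bigonMetric α β z v v := by
  rw [bigonMetric_apply]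
  have h0 : 2 / (1 - z ^ 2) * v ≠ 0 :=
    mul_ne_zero (div_ne_zero two_ne_zero (one_sub_sq_ne_zero hz)) hv
  refine mul_pos (pow_pos (div_pos (Real.sin_pos_of_mem_Ioo hβ) (conformalDenom_pos hβ _ _)) 2) ?_
  simp only [dRe_apply, dIm_apply]
  by_cases h1 : (2 / (1 - z ^ 2) * v).re = 0
  · have h2 : (2 / (1 - z ^ 2) * v).im ≠ 0 := fun h2 => h0 (Complex.ext h1 h2)
    have := mul_self_pos.2 h2
    have := mul_self_nonneg (2 / (1 - z ^ 2) * v).re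
    positivity
  · have := mul_self_pos.2 h1
    have := mul_self_nonneg (2 / (1 - z ^ 2) * v).im
    positivity

lemma exp_re_stripCoord {z : ℂ} (hz : z ∈ coordDomain) :
    Real.exp (stripCoord z).re = ‖1 + z‖ / ‖1 - z‖ := by
  rw [← Complex.norm_exp, exp_stripCoord hz, norm_div]

lemma cosh_re_stripCoord {z : ℂ} (hz : z ∈ coordDomain) :
    Real.cosh (stripCoord z).re = (1 + ‖z‖ ^ 2) / ‖1 - z ^ 2‖ := by
  have h1 : 0 < ‖1 - z‖ := norm_pos_iff.2 (sub_ne_zero.2 hz.1.symm)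
  have h2 : 0 < ‖1 + z‖ := norm_pos_iff.2
    fun h => ne_neg_one_of_mem_coordDomain hz (by linear_combination h)
  have h3 : ‖1 - z ^ 2‖ = ‖1 + z‖ * ‖1 - z‖ := by
    rw [← norm_mul]
    ring_nf
  have h4 : ‖1 + z‖ ^ 2 + ‖1 - z‖ ^ 2 = 2 * (1 + ‖z‖ ^ 2) := by
    have := parallelogram_law_with_norm ℝ (1 : ℂ) z
    simp only [norm_one] at this
    nlinarith
  rw [Real.cosh_eq, Real.exp_neg, exp_re_stripCoord hz, h3]
  field_simp
  linarith

/-- The Cayley map sends the disc into the closed right half-plane, where the argument is at most `π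
/ 2` in absolute value. -/
lemma abs_im_stripCoord_le {z : ℂ} (hz : z ∈ puncturedDisc) :
    |(stripCoord z).im| ≤ Real.pi / 2 := by
  rw [stripCoord, Complex.log_im, Complex.abs_arg_le_pi_div_two_iff]
  exact re_cayley_nonneg (mem_puncturedDisc.1 hz).1

lemma im_stripCoord_of_norm_eq_one {z : ℂ} (hz : ‖z‖ = 1) :
    (0 < z.im → (stripCoord z).im = Real.pi / 2) ∧
      (z.im < 0 → (stripCoord z).im = -(Real.pi / 2)) := by
  have hre : ((1 + z) / (1 - z)).re = 0 := by simp [re_cayley, hz]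
  have hn : z.im ≠ 0 → 0 < Complex.normSq (1 - z) := by
    intro h
    rw [Complex.normSq_pos]
    intro h'
    apply h
    simpa using congrArg Complex.im h'
  constructor <;> intro h
  · rw [stripCoord, Complex.log_im, Complex.arg_eq_pi_div_two_iff, im_cayley]
    exact ⟨hre, div_pos (by linarith) (hn h.ne')⟩
  · rw [stripCoord, Complex.log_im, Complex.arg_eq_neg_pi_div_two_iff, im_cayley]
    exact ⟨hre, div_neg_of_neg_of_pos (by linarith) (hn h.ne)⟩

lemma lunePhase_of_norm_eq_one (α : ℝ) {z : ℂ} (hz : ‖z‖ = 1) :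
    (0 < z.im → lunePhase α z = 0) ∧ (z.im < 0 → lunePhase α z = Real.pi * α) := by
  constructor <;> intro h
  · simp [lunePhase, (im_stripCoord_of_norm_eq_one hz).1 h]
  · rw [lunePhase, (im_stripCoord_of_norm_eq_one hz).2 h]
    ring

lemma lunePhase_mem_Icc {α : ℝ} (hα : 0 < α) {z : ℂ} (hz : z ∈ puncturedDisc) :
    lunePhase α z ∈ Set.Icc 0 (Real.pi * α) := by
  obtain ⟨h1, h2⟩ := abs_le.1 (abs_im_stripCoord_le hz)
  constructor <;> unfold lunePhase <;> nlinarith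

/-- Away from the vertices the set is locally a convex disc with nonempty interior. This lets
ordinary derivatives on `coordDomain` stand in for `fderivWithin`, also at boundary points. -/
lemma uniqueDiffWithinAt_inter_puncturedDisc {U : Set ℂ} (hU : IsOpen U) {z : ℂ}
    (hz : z ∈ U ∩ puncturedDisc) : UniqueDiffWithinAt ℝ (U ∩ puncturedDisc) z := by
  have h : UniqueDiffWithinAt ℝ (Metric.closedBall (0 : ℂ) 1) z :=
    uniqueDiffOn_convex (convex_closedBall (0 : ℂ) 1)
      (by rw [interior_closedBall _ one_ne_zero]; exact ⟨0, by simp⟩) z hz.2.1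
  have h2 : IsOpen (U ∩ {1, -1}ᶜ) := hU.inter (Set.toFinite _).isClosed.isOpen_compl
  convert h.inter (h2.mem_nhds ⟨hz.1, hz.2.2⟩) using 1
  ext y
  simp [puncturedDisc]
  tauto

/-! ### The developing map into the sphere -/

/-- The developing map of `bigonMetric α β` into the unit sphere. -/
def developingMap (α β : ℝ) (z : ℂ) : EuclideanSpace ℝ (Fin 3) :=
  (Real.cosh (stripCoord z).re + Real.cos β * Real.cos (lunePhase α z))⁻¹ •
    !₂[Real.cos (lunePhase α z) + Real.cos β * Real.cosh (stripCoord z).re,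
      Real.sin β * Real.sin (lunePhase α z), Real.sin β * Real.sinh (stripCoord z).re]

lemma contDiffOn_developingMap (α : ℝ) {β : ℝ} (hβ : β ∈ Set.Ioo 0 Real.pi) :
    ContDiffOn ℝ ∞ (developingMap α β) coordDomain := by
  have h1 := contDiffOn_re_stripCoord
  have h2 := contDiffOn_lunePhase α
  refine ContDiffOn.smul (ContDiffOn.inv ?_ fun z _ => (conformalDenom_pos hβ _ _).ne') ?_
  · exact h1.cosh.add (contDiffOn_const.mul h2.cos)
  · rw [contDiffOn_euclidean]
    intro i
    fin_cases i
    · exact h2.cos.add (contDiffOn_const.mul h1.cosh)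
    · exact contDiffOn_const.mul h2.sin
    · exact contDiffOn_const.mul h1.sinh

lemma norm_developingMap (α : ℝ) {β : ℝ} (hβ : β ∈ Set.Ioo 0 Real.pi) (z : ℂ) :
    ‖developingMap α β z‖ = 1 := by
  have hD := conformalDenom_pos hβ (stripCoord z).re (lunePhase α z)
  have e1 := Real.cosh_sq (stripCoord z).re
  have e2 := Real.sin_sq_add_cos_sq β
  have e3 := Real.sin_sq_add_cos_sq (lunePhase α z)
  rw [developingMap, norm_smul, norm_inv, Real.norm_of_nonneg hD.le, inv_mul_eq_one₀ hD.ne',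
    EuclideanSpace.norm_eq, eq_comm, Real.sqrt_eq_iff_mul_self_eq (by positivity) hD.le]
  simp only [Fin.sum_univ_three, Real.norm_eq_abs, sq_abs]
  simp
  linear_combination Real.sin β ^ 2 * (e3 - e1) -
    (Real.cos (lunePhase α z) ^ 2 - Real.cosh (stripCoord z).re ^ 2) * e2

lemma hasFDerivAt_developingMap (α : ℝ) {β : ℝ} (hβ : β ∈ Set.Ioo 0 Real.pi) {z : ℂ}
    (hz : z ∈ coordDomain) : HasFDerivAt (developingMap α β)
      (fderiv ℝ (developingMap α β) z) z :=
  (((contDiffOn_developingMap α hβ).contDiffAt (isOpen_coordDomain.mem_nhds hz)).differentiableAt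
    (by simp)).hasFDerivAt

/-- If `(n, D)` moves on the light cone `|n|² = D²`, then `n / D` moves on the unit sphere, and its
velocities have inner product `D⁻²` times the Minkowski product of those of `(n, D)`. The hypotheses
`hp`, `hq` are the derivative of the cone equation. -/
lemma projectedInner_of_lightlike {D n₁ n₂ n₃ p₁ p₂ p₃ q₁ q₂ q₃ dp dq : ℝ} (hD : D ≠ 0)
    (hn : n₁ ^ 2 + n₂ ^ 2 + n₃ ^ 2 = D ^ 2) (hp : n₁ * p₁ + n₂ * p₂ + n₃ * p₃ = D * dp)
    (hq : n₁ * q₁ + n₂ * q₂ + n₃ * q₃ = D * dq) :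
    (D⁻¹ * p₁ - n₁ * (D⁻¹ ^ 2 * dp)) * (D⁻¹ * q₁ - n₁ * (D⁻¹ ^ 2 * dq)) +
      (D⁻¹ * p₂ - n₂ * (D⁻¹ ^ 2 * dp)) * (D⁻¹ * q₂ - n₂ * (D⁻¹ ^ 2 * dq)) +
      (D⁻¹ * p₃ - n₃ * (D⁻¹ ^ 2 * dp)) * (D⁻¹ * q₃ - n₃ * (D⁻¹ ^ 2 * dq)) =
    D⁻¹ ^ 2 * (p₁ * q₁ + p₂ * q₂ + p₃ * q₃ - dp * dq) := by
  field_simp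
  linear_combination (dp * dq) * hn - D * dq * hp - D * dp * hq

lemma inner_fderiv_developingMap (α : ℝ) {β : ℝ} (hβ : β ∈ Set.Ioo 0 Real.pi) {z : ℂ}
    (hz : z ∈ coordDomain) (v w : ℂ) :
    inner ℝ (fderiv ℝ (developingMap α β) z v) (fderiv ℝ (developingMap α β) z w) =
      bigonMetric α β z v w := by
  have h1 := hasFDerivAt_re_stripCoord hz
  have h2 := hasFDerivAt_lunePhase α hz
  have hD := conformalDenom_pos hβ (stripCoord z).re (lunePhase α z)
  have hinv := (hasDerivAt_inv hD.ne').comp_hasFDerivAt z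
    (h1.cosh.add (h2.cos.const_mul (Real.cos β)))
  have hf := fun i : Fin 3 => (EuclideanSpace.proj (𝕜 := ℝ) i).hasFDerivAt.comp z
    (hasFDerivAt_developingMap α hβ hz)
  have hx := (hf 0).unique (hinv.mul (h2.cos.add (h1.cosh.const_mul (Real.cos β))))
  have hy := (hf 1).unique (hinv.mul (h2.sin.const_mul (Real.sin β)))
  have hw := (hf 2).unique (hinv.mul (h1.sinh.const_mul (Real.sin β)))
  have hx' := fun v => congrArg (fun A : ℂ →L[ℝ] ℝ => A v) hx
  have hy' := fun v => congrArg (fun A : ℂ →L[ℝ] ℝ => A v) hy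
  have hw' := fun v => congrArg (fun A : ℂ →L[ℝ] ℝ => A v) hw
  simp at hx' hy' hw'
  rw [bigonMetric_apply]
  simp only [PiLp.inner_apply, Fin.sum_univ_three, hx', hy', hw']
  have e1 := Real.cosh_sq (stripCoord z).re
  have e2 := Real.sin_sq_add_cos_sq β
  have e3 := Real.sin_sq_add_cos_sq (lunePhase α z)
  simp only [RCLike.inner_apply, conj_trivial]
  generalize Real.cosh (stripCoord z).re = ch, Real.sinh (stripCoord z).re = sh,
    Real.cos (lunePhase α z) = cy, Real.sin (lunePhase α z) = sy, Real.cos β = c,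
    Real.sin β = σ, dRe z v = a, dRe z w = a', dIm z v = b, dIm z w = b' at *
  -- Here `p`, `dp` and `q`, `dq` are the derivatives of `(n, D)` along `v` and `w`; the signs come
  -- from `dψ = -α dIm`.
  have key := projectedInner_of_lightlike (D := ch + c * cy) (n₁ := cy + c * ch) (n₂ := σ * sy)
    (n₃ := σ * sh) (p₁ := sy * (α * b) + c * (sh * a)) (p₂ := -(σ * (cy * (α * b))))
    (p₃ := σ * (ch * a)) (q₁ := sy * (α * b') + c * (sh * a')) (q₂ := -(σ * (cy * (α * b'))))
    (q₃ := σ * (ch * a')) (dp := sh * a + c * (sy * (α * b)))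
    (dq := sh * a' + c * (sy * (α * b'))) hD.ne'
    (by linear_combination σ ^ 2 * (e3 - e1) - (cy ^ 2 - ch ^ 2) * e2)
    (by linear_combination (-sy * cy * (α * b) + sh * ch * a) * e2)
    (by linear_combination (-sy * cy * (α * b') + sh * ch * a') * e2)
  -- The Minkowski product of the two velocities: up to `sin² β` it is the flat metric `ds² + dψ²`.
  have hpq : (sy * (α * b) + c * (sh * a)) * (sy * (α * b') + c * (sh * a')) +
      -(σ * (cy * (α * b))) * -(σ * (cy * (α * b'))) + σ * (ch * a) * (σ * (ch * a')) -
      (sh * a + c * (sy * (α * b))) * (sh * a' + c * (sy * (α * b'))) =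
      σ ^ 2 * (a * a' + α ^ 2 * (b * b')) := by
    linear_combination (σ ^ 2 * a * a') * e1 + (sh ^ 2 * a * a' - sy ^ 2 * α ^ 2 * b * b') * e2 +
      σ ^ 2 * α ^ 2 * b * b' * e3
  rw [hpq] at key
  rw [div_pow, div_eq_mul_inv, ← inv_pow] at *
  linear_combination key

/-- One developing map serves everywhere. Only the great circle changes: the upper edge lies in the
plane `y = 0`, the lower edge in the plane at angle `π α` to it, provided that `cos β sin (π α) =
0`. -/
lemma isLocallySphericalAt_bigonMetric {α β : ℝ} (hβ : β ∈ Set.Ioo 0 Real.pi)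
    (h : Real.cos β * Real.sin (Real.pi * α) = 0) {p : ℂ} (hp : p ∈ puncturedDisc) :
    IsLocallySphericalAt (bigonMetric α β) p := by
  have main : ∀ U : Set ℂ, IsOpen U → p ∈ U →
      (∃ n : EuclideanSpace ℝ (Fin 3), ‖n‖ = 1 ∧
        ∀ z ∈ U ∩ puncturedDisc, ‖z‖ = 1 → inner ℝ n (developingMap α β z) = 0) →
      IsLocallySphericalAt (bigonMetric α β) p := by
    intro U hU hpU hn
    have hsub : U ∩ puncturedDisc ⊆ coordDomain :=
      Set.inter_subset_right.trans puncturedDisc_subset_coordDomain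
    refine ⟨U, hU, hpU, developingMap α β, (contDiffOn_developingMap α hβ).mono hsub,
      fun z _ => norm_developingMap α hβ z, fun z hz v w => ?_, hn⟩
    rw [(hasFDerivAt_developingMap α hβ (hsub hz)).hasFDerivWithinAt.fderivWithin
      (uniqueDiffWithinAt_inter_puncturedDisc hU hz), inner_fderiv_developingMap α hβ (hsub hz)]
  rcases lt_trichotomy p.im 0 with hi | hi | hi
  · refine main {z | z.im < 0} (isOpen_lt Complex.continuous_im continuous_const) hi
      ⟨!₂[Real.sin (Real.pi * α), -Real.cos (Real.pi * α), 0], ?_, fun z hz hz1 => ?_⟩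
    · simp [EuclideanSpace.norm_eq, Fin.sum_univ_three]
    · have hψ := (lunePhase_of_norm_eq_one α hz1).2 hz.1
      rw [developingMap, inner_smul_right]
      simp only [PiLp.inner_apply, Fin.sum_univ_three, RCLike.inner_apply, conj_trivial, hψ]
      simp
      right
      rcases mul_eq_zero.1 h with hc | hs
      · have hσ : Real.sin β = 1 := by
          have := Real.sin_sq_add_cos_sq β
          have := Real.sin_pos_of_mem_Ioo hβ
          nlinarith
        rw [hc, hσ]
        ring
      · rw [hs]
        ring
  -- The only real points of the unit circle are the vertices, so `p` is interior; the boundary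
  -- condition is void on the open disc and any unit normal will do.
  · refine main (Metric.ball 0 1) Metric.isOpen_ball ?_ ⟨!₂[0, 1, 0], ?_, fun z hz hz1 => ?_⟩
    · rw [mem_ball_zero_iff]
      obtain ⟨h0, h1, h2⟩ := mem_puncturedDisc.1 hp
      refine lt_of_le_of_ne h0 fun hn => ?_
      have hre : p = p.re := Complex.ext rfl (by simpa using hi)
      rw [hre, Complex.norm_real, Real.norm_eq_abs, abs_eq zero_le_one] at hn
      rcases hn with hn | hn
      · exact h1 (by rw [hre, hn]; simp)
      · exact h2 (by rw [hre, hn]; simp)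
    · simp [EuclideanSpace.norm_eq, Fin.sum_univ_three]
    · exact absurd hz1 (mem_ball_zero_iff.1 hz.1).ne
  · refine main {z | 0 < z.im} (isOpen_lt continuous_const Complex.continuous_im) hi
      ⟨!₂[0, 1, 0], ?_, fun z hz hz1 => ?_⟩
    · simp [EuclideanSpace.norm_eq, Fin.sum_univ_three]
    · have hψ := (lunePhase_of_norm_eq_one α hz1).1 hz.1
      rw [developingMap, inner_smul_right]
      simp [PiLp.inner_apply, Fin.sum_univ_three, hψ]

/-! ### The Möbius transformation in logarithmic coordinates -/

/-- The lift to logarithmic coordinates of the Möbius transformation `ζ ↦ ζ / (1 + c ζ)`. -/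
def logMobius (c : ℝ) (V : ℂ) : ℂ := V - Complex.log (1 + c * Complex.exp V)

lemma one_add_mul_exp_mem_slitPlane {c : ℝ} {V : ℂ} (h : |c| * Real.exp V.re < 1) :
    1 + c * Complex.exp V ∈ Complex.slitPlane := by
  apply Complex.mem_slitPlane_of_norm_lt_one
  simpa [Complex.norm_exp] using h

lemma exp_logMobius {c : ℝ} {V : ℂ} (h : 1 + c * Complex.exp V ≠ 0) :
    Complex.exp (logMobius c V) = Complex.exp V / (1 + c * Complex.exp V) := by
  rw [logMobius, Complex.exp_sub, Complex.exp_log h]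

/-- The maps `ζ ↦ ζ / (1 + c ζ)` form a one-parameter group in `c`; on the slit plane the principal
logarithm respects the inversion. -/
lemma logMobius_neg_logMobius {c : ℝ} {V : ℂ} (h : 1 + c * Complex.exp V ∈ Complex.slitPlane) :
    logMobius (-c) (logMobius c V) = V := by
  have h0 := Complex.slitPlane_ne_zero h
  have h1 : 1 + ((-c : ℝ) : ℂ) * Complex.exp (logMobius c V) = (1 + c * Complex.exp V)⁻¹ := by
    rw [exp_logMobius h0]
    push_cast
    field_simp
    ring
  rw [logMobius, h1, Complex.log_inv _ (Complex.slitPlane_arg_ne_pi h), logMobius]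
  ring

lemma hasDerivAt_logMobius {c : ℝ} {V : ℂ} (h : 1 + c * Complex.exp V ∈ Complex.slitPlane) :
    HasDerivAt (logMobius c) (1 + c * Complex.exp V)⁻¹ V := by
  have h0 := Complex.slitPlane_ne_zero h
  refine ((hasDerivAt_id' V).fun_sub
    ((((Complex.hasDerivAt_exp V).const_mul (c : ℂ)).const_add 1).clog h)).congr_deriv ?_
  field_simp
  ring

/-- The function is the imaginary part of `logMobius q (iθ)`, with derivative `Re (1 + q exp
(iθ))⁻¹`, which is nonnegative since `|q| < 1`. -/
lemma monotone_sub_arg {q : ℝ} (hq : |q| < 1) :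
    Monotone fun θ : ℝ => θ - Complex.arg (1 + q * Complex.exp (θ * Complex.I)) := by
  have hs : ∀ θ : ℝ, 1 + q * Complex.exp (θ * Complex.I) ∈ Complex.slitPlane := fun θ =>
    one_add_mul_exp_mem_slitPlane (by simpa using hq)
  have hd : ∀ θ : ℝ, HasDerivAt
      -- The factor `-I` turns the imaginary part into a real part, as `HasDerivAt.real_of_complex`
      -- requires.
      (fun θ : ℝ => (logMobius q (θ * Complex.I) * -Complex.I).re)
      ((1 + q * Complex.exp (θ * Complex.I))⁻¹).re θ := by
    intro θ
    have h1 : HasDerivAt (fun x : ℂ => logMobius q (x * Complex.I) * -Complex.I)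
        (1 + q * Complex.exp (θ * Complex.I))⁻¹ (θ : ℂ) := by
      refine (((hasDerivAt_logMobius (hs θ)).comp (θ : ℂ)
        ((hasDerivAt_id' (θ : ℂ)).mul_const Complex.I)).mul_const (-Complex.I)).congr_deriv ?_
      rw [one_mul, mul_assoc, mul_neg, Complex.I_mul_I]
      ring
    exact h1.real_of_complex
  have he : (fun θ : ℝ => θ - Complex.arg (1 + q * Complex.exp (θ * Complex.I))) =
      fun θ : ℝ => (logMobius q (θ * Complex.I) * -Complex.I).re := by
    ext θ
    simp [logMobius, Complex.log_im]
  rw [he]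
  refine monotone_of_deriv_nonneg (fun θ => (hd θ).differentiableAt) fun θ => ?_
  rw [(hd θ).deriv, Complex.inv_re]
  refine div_nonneg ?_ (Complex.normSq_nonneg _)
  have : |q * Real.cos θ| ≤ |q| := by
    rw [abs_mul]
    exact mul_le_of_le_one_right (abs_nonneg _) (Real.abs_cos_le_one θ)
  simp [Complex.exp_ofReal_mul_I_re]
  linarith [(abs_le.1 this).1]

/-- On the lines `Im V = 0` and `Im V = A` the number `1 + c exp V` is real and positive, so the
height is unchanged there; monotonicity in `Im V` then keeps the strip between them invariant. -/
lemma im_logMobius_mem_Icc {c A : ℝ} (hA : c * Real.sin A = 0) {V : ℂ}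
    (h : |c| * Real.exp V.re < 1) (hV : V.im ∈ Set.Icc 0 A) :
    (logMobius c V).im ∈ Set.Icc 0 A := by
  set q : ℝ := c * Real.exp V.re with hq
  have hq1 : |q| < 1 := by rwa [hq, abs_mul, abs_of_pos (Real.exp_pos _)]
  have hm := monotone_sub_arg hq1
  have hexp : (c : ℂ) * Complex.exp V = q * Complex.exp (V.im * Complex.I) := by
    conv_lhs => rw [← Complex.re_add_im V, Complex.exp_add]
    rw [hq]
    push_cast
    ring
  have him : (logMobius c V).im =
      V.im - Complex.arg (1 + q * Complex.exp (V.im * Complex.I)) := by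
    rw [logMobius, Complex.sub_im, Complex.log_im, hexp]
  have harg : ∀ B : ℝ, c * Real.sin B = 0 →
      Complex.arg (1 + q * Complex.exp (B * Complex.I)) = 0 := by
    intro B hB
    rw [Complex.arg_eq_zero_iff]
    have : |q * Real.cos B| ≤ |q| := by
      rw [abs_mul]
      exact mul_le_of_le_one_right (abs_nonneg _) (Real.abs_cos_le_one B)
    constructor
    · simp [Complex.exp_ofReal_mul_I_re]
      linarith [(abs_le.1 this).1]
    · rw [Complex.add_im, Complex.im_ofReal_mul, Complex.exp_ofReal_mul_I_im, Complex.one_im, hq]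
      linear_combination Real.exp V.re * hB
  rw [him]
  constructor
  · have := hm hV.1
    beta_reduce at this
    rwa [harg 0 (by simp), sub_zero] at this
  · have := hm hV.2
    beta_reduce at this
    rwa [harg A hA, sub_zero] at this

lemma contDiffAt_logMobius {c : ℝ} {V : ℂ} (h : |c| * Real.exp V.re < 1) :
    ContDiffAt ℝ ∞ (logMobius c) V := by
  have ho : IsOpen {V : ℂ | |c| * Real.exp V.re < 1} :=
    isOpen_lt (by fun_prop) continuous_const
  have ha : AnalyticAt ℂ (logMobius c) V :=
    DifferentiableOn.analyticAt (s := {V : ℂ | |c| * Real.exp V.re < 1})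
      (fun y hy => (hasDerivAt_logMobius
        (one_add_mul_exp_mem_slitPlane hy)).differentiableAt.differentiableWithinAt)
      (ho.mem_nhds h)
  exact ha.contDiffAt.restrict_scalars ℝ

/-! ### The lune in logarithmic coordinates -/

/-- The logarithm of the developing map of the lune of angle `π α`, with the vertex `1` of the disc
at `-∞`. -/
def luneLog (α : ℝ) (z : ℂ) : ℂ := ⟨-(stripCoord z).re, lunePhase α z⟩

/-- The inverse of `luneLog α`. -/
def luneLogInv (α : ℝ) (V : ℂ) : ℂ :=
  (Complex.exp ⟨-V.re, Real.pi / 2 - V.im / α⟩ - 1) /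
    (Complex.exp ⟨-V.re, Real.pi / 2 - V.im / α⟩ + 1)

lemma contDiffOn_luneLog (α : ℝ) : ContDiffOn ℝ ∞ (luneLog α) coordDomain := by
  have h : luneLog α = fun z => Complex.equivRealProdCLM.symm
      (-(stripCoord z).re, lunePhase α z) := by
    ext z
    apply Complex.ext <;> simp [luneLog]
  rw [h]
  exact Complex.equivRealProdCLM.symm.contDiff.comp_contDiffOn
    (contDiffOn_re_stripCoord.neg.prodMk (contDiffOn_lunePhase α))

lemma luneLogInv_luneLog {α : ℝ} (hα : 0 < α) {z : ℂ} (hz : z ∈ coordDomain) :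
    luneLogInv α (luneLog α z) = z := by
  have h : (⟨-(luneLog α z).re, Real.pi / 2 - (luneLog α z).im / α⟩ : ℂ) = stripCoord z := by
    apply Complex.ext
    · simp [luneLog]
    · simp only [luneLog, lunePhase]
      field_simp
      ring
  have h1 : (1 : ℂ) - z ≠ 0 := sub_ne_zero.2 hz.1.symm
  rw [luneLogInv, h, exp_stripCoord hz]
  have h2 : (1 + z) / (1 - z) + 1 ≠ 0 := by
    have : (1 + z) / (1 - z) + 1 = 2 / (1 - z) := by
      field_simp
      ring
    rw [this]
    exact div_ne_zero two_ne_zero h1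
  rw [div_eq_iff h2]
  field_simp
  ring

/-- The exponential is the Cayley image of the point to be recovered. Its lying in the right
half-plane keeps it away from `-1` and puts `luneLogInv α V` in the disc. -/
lemma re_exp_nonneg {α : ℝ} (hα : 0 < α) {V : ℂ} (hV : V.im ∈ Set.Icc 0 (Real.pi * α)) :
    0 ≤ (Complex.exp ⟨-V.re, Real.pi / 2 - V.im / α⟩).re := by
  rw [Complex.exp_re]
  refine mul_nonneg (Real.exp_nonneg _) (Real.cos_nonneg_of_mem_Icc ?_)
  have h1 : 0 ≤ V.im / α := div_nonneg hV.1 hα.le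
  have h2 : V.im / α ≤ Real.pi := (div_le_iff₀ hα).2 hV.2
  constructor <;> simp only <;> linarith

lemma exp_add_one_ne_zero {w : ℂ} (hw : 0 ≤ (Complex.exp w).re) : Complex.exp w + 1 ≠ 0 := by
  intro h
  have := congrArg Complex.re h
  simp at this
  linarith

lemma contDiffOn_luneLogInv {α : ℝ} (hα : 0 < α) :
    ContDiffOn ℝ ∞ (luneLogInv α) {V | V.im ∈ Set.Icc 0 (Real.pi * α)} := by
  have h : ContDiff ℝ ∞ fun V : ℂ => Complex.exp ⟨-V.re, Real.pi / 2 - V.im / α⟩ := by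
    have : (fun V : ℂ => (⟨-V.re, Real.pi / 2 - V.im / α⟩ : ℂ)) = fun V =>
        Complex.equivRealProdCLM.symm
          (-Complex.reCLM V, Real.pi / 2 - Complex.imCLM V / α) := by
      ext V
      apply Complex.ext <;> simp
    refine ContDiff.cexp ?_
    rw [this]
    exact Complex.equivRealProdCLM.symm.contDiff.comp (by fun_prop)
  unfold luneLogInv
  simp only [div_eq_mul_inv _ (Complex.exp _ + 1)]
  exact (h.sub contDiff_const).contDiffOn.mul
    ((h.add contDiff_const).contDiffOn.inv
      fun V hV => exp_add_one_ne_zero (re_exp_nonneg hα hV))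

lemma luneLogInv_mem {α : ℝ} (hα : 0 < α) {V : ℂ} (hV : V.im ∈ Set.Icc 0 (Real.pi * α)) :
    luneLogInv α V ∈ puncturedDisc := by
  have hre := re_exp_nonneg hα hV
  have h0 := exp_add_one_ne_zero hre
  rw [mem_puncturedDisc, luneLogInv]
  generalize hw : (⟨-V.re, Real.pi / 2 - V.im / α⟩ : ℂ) = w at *
  refine ⟨?_, ?_, ?_⟩
  · rw [norm_div, div_le_one (norm_pos_iff.2 h0)]
    apply le_of_sq_le_sq _ (norm_nonneg _)
    rw [← Complex.normSq_eq_norm_sq, ← Complex.normSq_eq_norm_sq, Complex.normSq_apply,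
      Complex.normSq_apply]
    simp
    nlinarith
  · rw [Ne, div_eq_one_iff_eq h0]
    intro h
    have : (2 : ℂ) = 0 := by linear_combination -h
    exact two_ne_zero this
  · rw [Ne, div_eq_iff h0]
    intro h
    have : 2 * Complex.exp w = 0 := by linear_combination h
    exact mul_ne_zero two_ne_zero (Complex.exp_ne_zero w) this

lemma luneLog_luneLogInv {α : ℝ} (hα : 0 < α) {V : ℂ} (hV : V.im ∈ Set.Icc 0 (Real.pi * α)) :
    luneLog α (luneLogInv α V) = V := by
  have h0 := exp_add_one_ne_zero (re_exp_nonneg hα hV)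
  have h1 : 0 ≤ V.im / α := div_nonneg hV.1 hα.le
  have h2 : V.im / α ≤ Real.pi := (div_le_iff₀ hα).2 hV.2
  have h : stripCoord (luneLogInv α V) = ⟨-V.re, Real.pi / 2 - V.im / α⟩ := by
    rw [stripCoord, luneLogInv]
    have hπ := Real.pi_pos
    have hlog := Complex.log_exp (x := (⟨-V.re, Real.pi / 2 - V.im / α⟩ : ℂ))
      (by simp only; linarith) (by simp only; linarith)
    generalize (⟨-V.re, Real.pi / 2 - V.im / α⟩ : ℂ) = w at *
    rw [show (1 + (Complex.exp w - 1) / (Complex.exp w + 1)) /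
      (1 - (Complex.exp w - 1) / (Complex.exp w + 1)) = Complex.exp w by field_simp; ring, hlog]
  apply Complex.ext
  · simp [luneLog, h]
  · simp only [luneLog, lunePhase, h]
    field_simp
    ring

/-! ### Polar coordinates at the vertex `1` -/

/-- Geodesic polar coordinates of `bigonMetric α β` around the vertex `1`. -/
def polarChart (α β : ℝ) (z : ℂ) : ℝ × ℝ :=
  (2 * Real.arctan (Real.sin β * Real.exp (logMobius (Real.cos β) (luneLog α z)).re),
    (logMobius (Real.cos β) (luneLog α z)).im)

/-- The inverse of `polarChart α β`. -/
def polarChartInv (α β : ℝ) (x : ℝ × ℝ) : ℂ :=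
  luneLogInv α (logMobius (-Real.cos β) ⟨Real.log (Real.tan (x.1 / 2) / Real.sin β), x.2⟩)

/-- The domain of `polarChart α β`, except for points outside the disc. -/
def polarDomain (α β : ℝ) : Set ℂ :=
  Metric.ball 1 (1 / 2) ∪ {z ∈ coordDomain | 2 * ‖Complex.exp (luneLog α z)‖ <
    ‖1 + Real.cos β * Complex.exp (luneLog α z)‖}

lemma isOpen_polarDomain (α β : ℝ) : IsOpen (polarDomain α β) := by
  refine Metric.isOpen_ball.union ?_
  have hc := (contDiffOn_luneLog α).continuousOn
  have h1 : ContinuousOn (fun z => ‖1 + Real.cos β * Complex.exp (luneLog α z)‖ -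
      2 * ‖Complex.exp (luneLog α z)‖) coordDomain := by fun_prop
  convert h1.isOpen_inter_preimage isOpen_coordDomain isOpen_Ioi (t := Set.Ioi 0) using 1
  ext z
  simp

lemma norm_exp_luneLog (α : ℝ) {z : ℂ} (hz : z ∈ coordDomain) :
    ‖Complex.exp (luneLog α z)‖ = ‖1 - z‖ / ‖1 + z‖ := by
  rw [Complex.norm_exp, luneLog, Real.exp_neg, exp_re_stripCoord hz, inv_div]

/-- The inequality says `|ζ / (1 + cos β · ζ)| < 1 / 2`, that is, `ρ < 2 arctan (sin β / 2)`. The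
ball is there only to make the open set contain the vertex; inside the disc it adds nothing, as `|ζ|
< 1 / 3` on it. -/
lemma mem_polarDomain_inter_iff {α β : ℝ} {z : ℂ} :
    z ∈ polarDomain α β ∩ puncturedDisc ↔ z ∈ puncturedDisc ∧
      2 * ‖Complex.exp (luneLog α z)‖ < ‖1 + Real.cos β * Complex.exp (luneLog α z)‖ := by
  constructor
  · rintro ⟨h | h, hz⟩
    · refine ⟨hz, ?_⟩
      rw [mem_ball_iff_norm'] at h
      have h1 : 3 / 2 < ‖1 + z‖ := by
        have : ‖(2 : ℂ)‖ ≤ ‖1 + z‖ + ‖1 - z‖ := by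
          refine le_trans (le_of_eq ?_) (norm_add_le _ _)
          ring_nf
        norm_num at this
        linarith
      have h2 : ‖Complex.exp (luneLog α z)‖ < 1 / 3 := by
        rw [norm_exp_luneLog α (puncturedDisc_subset_coordDomain hz), div_lt_iff₀ (by linarith)]
        linarith
      have h3 : ‖(Real.cos β : ℂ) * Complex.exp (luneLog α z)‖ ≤ ‖Complex.exp (luneLog α z)‖ := by
        rw [norm_mul, Complex.norm_real]
        exact mul_le_of_le_one_left (norm_nonneg _) (Real.abs_cos_le_one β)
      have h4 := norm_sub_le_norm_add (1 : ℂ) (Real.cos β * Complex.exp (luneLog α z))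
      rw [norm_one] at h4
      linarith
    · exact ⟨hz, h.2⟩
  · rintro ⟨hz, h⟩
    exact ⟨Or.inr ⟨puncturedDisc_subset_coordDomain hz, h⟩, hz⟩

/-- The triangle inequality gives `2 |ζ| < 1 + |ζ|`. This is why the cutoff `1 / 2` is convenient:
`1 + c ζ` then stays in the slit plane. -/
lemma exp_re_lt_one {c : ℝ} (hc : |c| < 1) {V : ℂ}
    (h : 2 * ‖Complex.exp V‖ < ‖1 + c * Complex.exp V‖) : Real.exp V.re < 1 := by
  have h1 : ‖(c : ℂ) * Complex.exp V‖ ≤ ‖Complex.exp V‖ := by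
    rw [norm_mul, Complex.norm_real]
    exact mul_le_of_le_one_left (norm_nonneg _) hc.le
  have h2 := norm_add_le (1 : ℂ) (c * Complex.exp V)
  rw [norm_one] at h2
  rw [← Complex.norm_exp]
  linarith

lemma abs_mul_exp_lt_one {c : ℝ} (hc : |c| < 1) {V : ℂ} (h : Real.exp V.re < 1) :
    |c| * Real.exp V.re < 1 :=
  mul_lt_one_of_nonneg_of_lt_one_left (abs_nonneg _) hc h.le

lemma abs_cos_mul_exp_lt_one {α β : ℝ} (hβ : β ∈ Set.Ioo 0 Real.pi) {z : ℂ}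
    (hz : z ∈ polarDomain α β ∩ puncturedDisc) :
    |Real.cos β| * Real.exp (luneLog α z).re < 1 :=
  abs_mul_exp_lt_one (abs_cos_lt_one hβ)
    (exp_re_lt_one (abs_cos_lt_one hβ) (mem_polarDomain_inter_iff.1 hz).2)

lemma contDiffOn_polarChart {α β : ℝ} (hβ : β ∈ Set.Ioo 0 Real.pi) :
    ContDiffOn ℝ ∞ (polarChart α β) (polarDomain α β ∩ puncturedDisc) := by
  have h : ContDiffOn ℝ ∞ (fun z => logMobius (Real.cos β) (luneLog α z))
      (polarDomain α β ∩ puncturedDisc) := fun z hz =>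
    (contDiffAt_logMobius (abs_cos_mul_exp_lt_one hβ hz)).comp_contDiffWithinAt z
      (((contDiffOn_luneLog α).mono puncturedDisc_subset_coordDomain).mono
        Set.inter_subset_right z hz)
  have hre := Complex.reCLM.contDiff.comp_contDiffOn h
  have him := Complex.imCLM.contDiff.comp_contDiffOn h
  exact (contDiffOn_const.mul (contDiffOn_const.mul hre.exp).arctan).prodMk him

lemma exp_re_logMobius_eq {c : ℝ} {V : ℂ} (h : |c| * Real.exp V.re < 1) :
    Real.exp (logMobius c V).re = ‖Complex.exp V‖ / ‖1 + c * Complex.exp V‖ := by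
  rw [← Complex.norm_exp, exp_logMobius (Complex.slitPlane_ne_zero
    (one_add_mul_exp_mem_slitPlane h)), norm_div]

lemma mapsTo_polarChart {α β : ℝ} (hα : 0 < α) (hβ : β ∈ Set.Ioo 0 Real.pi)
    (h : Real.cos β * Real.sin (Real.pi * α) = 0) :
    Set.MapsTo (polarChart α β) (polarDomain α β ∩ puncturedDisc)
      (Set.Ioo 0 (2 * Real.arctan (Real.sin β / 2)) ×ˢ Set.Icc 0 (Real.pi * α)) := by
  intro z hz
  have hσ := Real.sin_pos_of_mem_Ioo hβ
  have h1 := abs_cos_mul_exp_lt_one hβ hz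
  refine ⟨⟨?_, ?_⟩, ?_⟩
  · have : 0 < Real.arctan (Real.sin β * Real.exp (logMobius (Real.cos β) (luneLog α z)).re) :=
      Real.arctan_pos.2 (by positivity)
    simp only [polarChart]
    linarith
  · have h2 := (mem_polarDomain_inter_iff.1 hz).2
    have h3 : Real.exp (logMobius (Real.cos β) (luneLog α z)).re < 1 / 2 := by
      rw [exp_re_logMobius_eq h1, div_lt_iff₀]
      · linarith
      · exact lt_of_le_of_lt (by positivity) h2
    simp only [polarChart]
    have := Real.arctan_strictMono (show Real.sin β *
      Real.exp (logMobius (Real.cos β) (luneLog α z)).re < Real.sin β / 2 by nlinarith)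
    linarith
  · exact im_logMobius_mem_Icc h h1 (lunePhase_mem_Icc hα hz.2)

lemma tan_half_mem {β ρ : ℝ} (hβ : β ∈ Set.Ioo 0 Real.pi)
    (hρ : ρ ∈ Set.Ioo 0 (2 * Real.arctan (Real.sin β / 2))) :
    ρ / 2 ∈ Set.Ioo 0 (Real.pi / 2) ∧ 0 < Real.tan (ρ / 2) / Real.sin β ∧
      Real.tan (ρ / 2) / Real.sin β < 1 / 2 := by
  have hσ := Real.sin_pos_of_mem_Ioo hβ
  have h1 := Real.arctan_lt_pi_div_two (Real.sin β / 2)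
  have h2 : ρ / 2 ∈ Set.Ioo 0 (Real.pi / 2) := ⟨by linarith [hρ.1], by linarith [hρ.2]⟩
  refine ⟨h2, div_pos (Real.tan_pos_of_pos_of_lt_pi_div_two h2.1 h2.2) hσ, ?_⟩
  rw [div_lt_iff₀ hσ]
  have := Real.tan_lt_tan_of_lt_of_lt_pi_div_two (x := ρ / 2)
    (y := Real.arctan (Real.sin β / 2)) (by linarith [h2.1, Real.pi_pos]) h1 (by linarith [hρ.2])
  rw [Real.tan_arctan] at this
  linarith

lemma exp_log_tan_half_lt {β : ℝ} (hβ : β ∈ Set.Ioo 0 Real.pi) {x : ℝ × ℝ}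
    (hx : x.1 ∈ Set.Ioo 0 (2 * Real.arctan (Real.sin β / 2))) :
    Real.exp (⟨Real.log (Real.tan (x.1 / 2) / Real.sin β), x.2⟩ : ℂ).re < 1 / 2 := by
  simp only
  rw [Real.exp_log (tan_half_mem hβ hx).2.1]
  exact (tan_half_mem hβ hx).2.2

lemma logMobius_neg_mem {α β : ℝ} (hβ : β ∈ Set.Ioo 0 Real.pi)
    (h : Real.cos β * Real.sin (Real.pi * α) = 0) {x : ℝ × ℝ}
    (hx : x ∈ Set.Ioo 0 (2 * Real.arctan (Real.sin β / 2)) ×ˢ Set.Icc 0 (Real.pi * α)) :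
    |-Real.cos β| * Real.exp (⟨Real.log (Real.tan (x.1 / 2) / Real.sin β), x.2⟩ : ℂ).re < 1 ∧
    (logMobius (-Real.cos β) ⟨Real.log (Real.tan (x.1 / 2) / Real.sin β), x.2⟩).im ∈
      Set.Icc 0 (Real.pi * α) := by
  have h1 : |-Real.cos β| *
      Real.exp (⟨Real.log (Real.tan (x.1 / 2) / Real.sin β), x.2⟩ : ℂ).re < 1 :=
    abs_mul_exp_lt_one (by rw [abs_neg]; exact abs_cos_lt_one hβ)
      ((exp_log_tan_half_lt hβ hx.1).trans (by norm_num))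
  exact ⟨h1, im_logMobius_mem_Icc (by linear_combination -h) h1 hx.2⟩

lemma contDiffOn_polarChartInv {α β : ℝ} (hα : 0 < α) (hβ : β ∈ Set.Ioo 0 Real.pi)
    (h : Real.cos β * Real.sin (Real.pi * α) = 0) :
    ContDiffOn ℝ ∞ (polarChartInv α β)
      (Set.Ioo 0 (2 * Real.arctan (Real.sin β / 2)) ×ˢ Set.Icc 0 (Real.pi * α)) := by
  have hσ := Real.sin_pos_of_mem_Ioo hβ
  refine (contDiffOn_luneLogInv hα).comp (f := fun x : ℝ × ℝ =>
    logMobius (-Real.cos β) ⟨Real.log (Real.tan (x.1 / 2) / Real.sin β), x.2⟩) ?_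
    fun x hx => (logMobius_neg_mem hβ h hx).2
  intro x hx
  obtain ⟨hm, hpos, -⟩ := tan_half_mem hβ hx.1
  have hcos : Real.cos (x.1 / 2) ≠ 0 :=
    (Real.cos_pos_of_mem_Ioo ⟨by linarith [hm.1, Real.pi_pos], hm.2⟩).ne'
  refine ContDiffAt.comp_contDiffWithinAt (f := fun x : ℝ × ℝ =>
    (⟨Real.log (Real.tan (x.1 / 2) / Real.sin β), x.2⟩ : ℂ)) x
    (contDiffAt_logMobius (logMobius_neg_mem hβ h hx).1) ?_
  have h1 : ContDiffAt ℝ ∞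
      (fun x : ℝ × ℝ => Real.log (Real.tan (x.1 / 2) / Real.sin β)) x := by
    refine ContDiffAt.log (ContDiffAt.div ?_ contDiffAt_const hσ.ne') hpos.ne'
    exact ContDiffAt.comp (f := fun x : ℝ × ℝ => x.1 / 2) x (Real.contDiffAt_tan.2 hcos)
      (by fun_prop)
  exact (Complex.equivRealProdCLM.symm.contDiff.contDiffAt.comp x
    (h1.prodMk contDiffAt_snd)).contDiffWithinAt

lemma luneLog_polarChartInv {α β : ℝ} (hα : 0 < α) (hβ : β ∈ Set.Ioo 0 Real.pi)
    (h : Real.cos β * Real.sin (Real.pi * α) = 0) {x : ℝ × ℝ}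
    (hx : x ∈ Set.Ioo 0 (2 * Real.arctan (Real.sin β / 2)) ×ˢ Set.Icc 0 (Real.pi * α)) :
    luneLog α (polarChartInv α β x) =
      logMobius (-Real.cos β) ⟨Real.log (Real.tan (x.1 / 2) / Real.sin β), x.2⟩ :=
  luneLog_luneLogInv hα (logMobius_neg_mem hβ h hx).2

lemma mapsTo_polarChartInv {α β : ℝ} (hα : 0 < α) (hβ : β ∈ Set.Ioo 0 Real.pi)
    (h : Real.cos β * Real.sin (Real.pi * α) = 0) :
    Set.MapsTo (polarChartInv α β)
      (Set.Ioo 0 (2 * Real.arctan (Real.sin β / 2)) ×ˢ Set.Icc 0 (Real.pi * α))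
      (polarDomain α β ∩ puncturedDisc) := by
  intro x hx
  obtain ⟨h1, h2⟩ := logMobius_neg_mem hβ h hx
  rw [mem_polarDomain_inter_iff]
  refine ⟨luneLogInv_mem hα h2, ?_⟩
  rw [luneLog_polarChartInv hα hβ h hx]
  have hlt := exp_log_tan_half_lt hβ hx.1
  generalize (⟨Real.log (Real.tan (x.1 / 2) / Real.sin β), x.2⟩ : ℂ) = L at *
  have h0 := Complex.slitPlane_ne_zero (one_add_mul_exp_mem_slitPlane h1)
  have h3 : 1 + Real.cos β * Complex.exp (logMobius (-Real.cos β) L) =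
      1 / (1 + (-Real.cos β : ℝ) * Complex.exp L) := by
    rw [exp_logMobius h0, eq_div_iff h0, add_mul, mul_assoc, div_mul_cancel₀ _ h0]
    push_cast
    ring
  rw [h3, exp_logMobius h0, norm_div, norm_div, norm_one, Complex.norm_exp, ← mul_div_assoc]
  exact div_lt_div_of_pos_right (by linarith) (norm_pos_iff.2 h0)

lemma invOn_polarChart {α β : ℝ} (hα : 0 < α) (hβ : β ∈ Set.Ioo 0 Real.pi)
    (h : Real.cos β * Real.sin (Real.pi * α) = 0) :
    Set.InvOn (polarChartInv α β) (polarChart α β) (polarDomain α β ∩ puncturedDisc)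
      (Set.Ioo 0 (2 * Real.arctan (Real.sin β / 2)) ×ˢ Set.Icc 0 (Real.pi * α)) := by
  have hσ := Real.sin_pos_of_mem_Ioo hβ
  constructor
  · intro z hz
    have h1 := abs_cos_mul_exp_lt_one hβ hz
    have h2 : (⟨Real.log (Real.tan ((polarChart α β z).1 / 2) / Real.sin β),
        (polarChart α β z).2⟩ : ℂ) = logMobius (Real.cos β) (luneLog α z) := by
      apply Complex.ext
      · simp only [polarChart]
        rw [mul_div_cancel_left₀ _ two_ne_zero, Real.tan_arctan, mul_div_cancel_left₀ _ hσ.ne',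
          Real.log_exp]
      · rfl
    rw [polarChartInv, h2, logMobius_neg_logMobius (one_add_mul_exp_mem_slitPlane h1),
      luneLogInv_luneLog hα (puncturedDisc_subset_coordDomain hz.2)]
  · intro x hx
    obtain ⟨h1, h2⟩ := logMobius_neg_mem hβ h hx
    obtain ⟨hm, hpos, -⟩ := tan_half_mem hβ hx.1
    have h3 := logMobius_neg_logMobius (one_add_mul_exp_mem_slitPlane h1)
    rw [neg_neg] at h3
    rw [polarChart, luneLog_polarChartInv hα hβ h hx, h3]
    refine Prod.ext ?_ rfl
    simp only
    rw [Real.exp_log hpos, mul_div_cancel₀ _ hσ.ne', Real.arctan_tan (by linarith [hm.1, Real.pi_pos]) hm.2]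
    ring

lemma arctan_le_self {x : ℝ} (hx : 0 ≤ x) : Real.arctan x ≤ x := by
  simpa using Real.le_tan (Real.arctan_nonneg.2 hx) (Real.arctan_lt_pi_div_two x)

lemma tendsto_polarChart {α β : ℝ} (hβ : β ∈ Set.Ioo 0 Real.pi) :
    Filter.Tendsto (fun z => (polarChart α β z).1)
      (𝓝[polarDomain α β ∩ puncturedDisc] 1) (𝓝 0) := by
  have hσ := Real.sin_pos_of_mem_Ioo hβ
  have hc : 0 < 1 - |Real.cos β| := sub_pos.2 (abs_cos_lt_one hβ)
  have hlim : Filter.Tendsto (fun z : ℂ => 2 * (Real.sin β *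
      (‖1 - z‖ / ‖1 + z‖ / (1 - |Real.cos β|)))) (𝓝[polarDomain α β ∩ puncturedDisc] 1) (𝓝 0) := by
    have : ContinuousAt (fun z : ℂ => 2 * (Real.sin β *
        (‖1 - z‖ / ‖1 + z‖ / (1 - |Real.cos β|)))) 1 := by
      have h2 : ‖(1 : ℂ) + 1‖ ≠ 0 := by norm_num
      fun_prop (disch := assumption)
    have h := this.tendsto
    simp only [sub_self, norm_zero, zero_div, mul_zero] at h
    exact h.mono_left nhdsWithin_le_nhds
  refine tendsto_of_tendsto_of_tendsto_of_le_of_le' tendsto_const_nhds hlim ?_ ?_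
  · refine Filter.Eventually.of_forall fun z => ?_
    have : 0 ≤ Real.arctan (Real.sin β * Real.exp (logMobius (Real.cos β) (luneLog α z)).re) :=
      Real.arctan_nonneg.2 (by positivity)
    simp only [polarChart]
    linarith
  · filter_upwards [self_mem_nhdsWithin] with z hz
    have h1 := abs_cos_mul_exp_lt_one hβ hz
    have h2 := exp_re_lt_one (abs_cos_lt_one hβ) (mem_polarDomain_inter_iff.1 hz).2
    simp only [polarChart]
    gcongr
    refine (arctan_le_self (by positivity)).trans ?_
    gcongr
    rw [exp_re_logMobius_eq h1, norm_exp_luneLog α (puncturedDisc_subset_coordDomain hz.2)]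
    gcongr
    have h3 : ‖(Real.cos β : ℂ) * Complex.exp (luneLog α z)‖ ≤ |Real.cos β| := by
      rw [norm_mul, Complex.norm_real, Complex.norm_exp]
      exact mul_le_of_le_one_right (abs_nonneg _) h2.le
    have h4 := norm_sub_le_norm_add (1 : ℂ) (Real.cos β * Complex.exp (luneLog α z))
    rw [norm_one] at h4
    linarith

lemma sin_two_mul_arctan (u : ℝ) : Real.sin (2 * Real.arctan u) = 2 * u / (1 + u ^ 2) := by
  have h : 0 < 1 + u ^ 2 := by positivity
  rw [Real.sin_two_mul, Real.sin_arctan, Real.cos_arctan]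
  field_simp
  rw [Real.sq_sqrt h.le]

lemma hasFDerivAt_luneLog (α : ℝ) {z : ℂ} (hz : z ∈ coordDomain) :
    HasFDerivAt (luneLog α) ((Complex.equivRealProdCLM.symm : ℝ × ℝ →L[ℝ] ℂ) ∘L
      (-dRe z).prod (-α • dIm z)) z :=
  Complex.equivRealProdCLM.symm.hasFDerivAt.comp z
    ((hasFDerivAt_re_stripCoord hz).neg.prodMk (hasFDerivAt_lunePhase α hz))

lemma fderivWithin_polarChart {α β : ℝ} (hβ : β ∈ Set.Ioo 0 Real.pi) {z : ℂ}
    (hz : z ∈ polarDomain α β ∩ puncturedDisc) (v : ℂ) :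
    fderivWithin ℝ (polarChart α β) (polarDomain α β ∩ puncturedDisc) z v =
      (2 * (Real.sin β * Real.exp (logMobius (Real.cos β) (luneLog α z)).re) /
          (1 + (Real.sin β * Real.exp (logMobius (Real.cos β) (luneLog α z)).re) ^ 2) *
          ((1 + Real.cos β * Complex.exp (luneLog α z))⁻¹ * ⟨-dRe z v, -α * dIm z v⟩).re,
        ((1 + Real.cos β * Complex.exp (luneLog α z))⁻¹ * ⟨-dRe z v, -α * dIm z v⟩).im) := by
  have hd := puncturedDisc_subset_coordDomain hz.2
  have h1 := (hasDerivAt_logMobius (one_add_mul_exp_mem_slitPlane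
    (abs_cos_mul_exp_lt_one hβ hz))).hasFDerivAt.restrictScalars ℝ
  have h2 := h1.comp z (hasFDerivAt_luneLog α hd)
  have hre := Complex.reCLM.hasFDerivAt.comp z h2
  have him := Complex.imCLM.hasFDerivAt.comp z h2
  have h3 := ((hre.exp.const_mul (Real.sin β)).arctan.const_mul 2).prodMk him
  have h4 := HasFDerivWithinAt.fderivWithin (h3.hasFDerivWithinAt
    (s := polarDomain α β ∩ puncturedDisc))
    (uniqueDiffWithinAt_inter_puncturedDisc (isOpen_polarDomain α β) hz)
  refine (congrArg (fun A : ℂ →L[ℝ] ℝ × ℝ => A v) h4).trans ?_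
  have hv : Complex.equivRealProdCLM.symm (-dRe z v, -(α * dIm z v)) =
      ⟨-dRe z v, -(α * dIm z v)⟩ := rfl
  refine Prod.ext ?_ ?_
  · simp [-Complex.mul_re, hv]
    rw [mul_comm (⟨_, _⟩ : ℂ)]
    ring
  · simp [-Complex.mul_im, hv]
    rw [mul_comm (⟨_, _⟩ : ℂ)]

/-- With `W = logMobius (cos β) V` one has `ρ = 2 arctan (sin β exp (Re W))`, hence `dρ = sin ρ · d
Re W`, and the polar metric is `sin² ρ |dW|²` with `dW = m dV`. What remains is the identity of
conformal factors `hKm`. -/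
lemma bigonMetric_eq_polar {α β : ℝ} (hβ : β ∈ Set.Ioo 0 Real.pi) {z : ℂ}
    (hz : z ∈ polarDomain α β ∩ puncturedDisc) (v w : ℂ) :
    bigonMetric α β z v w =
      (fderivWithin ℝ (polarChart α β) (polarDomain α β ∩ puncturedDisc) z v).1 *
          (fderivWithin ℝ (polarChart α β) (polarDomain α β ∩ puncturedDisc) z w).1 +
        Real.sin (polarChart α β z).1 ^ 2 *
          ((fderivWithin ℝ (polarChart α β) (polarDomain α β ∩ puncturedDisc) z v).2 *
            (fderivWithin ℝ (polarChart α β) (polarDomain α β ∩ puncturedDisc) z w).2) := by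
  have hb := abs_cos_mul_exp_lt_one hβ hz
  have h0 := Complex.slitPlane_ne_zero (one_add_mul_exp_mem_slitPlane hb)
  have hD := conformalDenom_pos hβ (stripCoord z).re (lunePhase α z)
  rw [fderivWithin_polarChart hβ hz, fderivWithin_polarChart hβ hz, bigonMetric_apply]
  simp only [polarChart]
  rw [sin_two_mul_arctan]
  set m : ℂ := (1 + Real.cos β * Complex.exp (luneLog α z))⁻¹ with hm
  set K : ℝ := 2 * (Real.sin β * Real.exp (logMobius (Real.cos β) (luneLog α z)).re) /
    (1 + (Real.sin β * Real.exp (logMobius (Real.cos β) (luneLog α z)).re) ^ 2) with hK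
  have hKm : K ^ 2 * Complex.normSq m = (Real.sin β /
      (Real.cosh (stripCoord z).re + Real.cos β * Real.cos (lunePhase α z))) ^ 2 := by
    have hx : 0 < Real.exp (-(stripCoord z).re) := Real.exp_pos _
    have hn : ‖1 + Real.cos β * Complex.exp (luneLog α z)‖ ^ 2 = 1 +
        2 * Real.cos β * Real.exp (-(stripCoord z).re) * Real.cos (lunePhase α z) +
        Real.cos β ^ 2 * Real.exp (-(stripCoord z).re) ^ 2 := by
      rw [← Complex.normSq_eq_norm_sq, Complex.normSq_apply]
      simp only [Complex.add_re, Complex.add_im, Complex.one_re, Complex.one_im,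
        Complex.re_ofReal_mul, Complex.im_ofReal_mul, Complex.exp_re, Complex.exp_im, luneLog]
      linear_combination Real.cos β ^ 2 * Real.exp (-(stripCoord z).re) ^ 2 *
        Real.sin_sq_add_cos_sq (lunePhase α z)
    have hn0 : 0 < ‖1 + Real.cos β * Complex.exp (luneLog α z)‖ := norm_pos_iff.2 h0
    have hch : Real.cosh (stripCoord z).re =
        (1 + Real.exp (-(stripCoord z).re) ^ 2) / (2 * Real.exp (-(stripCoord z).re)) := by
      have hE : Real.exp (stripCoord z).re * Real.exp (-(stripCoord z).re) = 1 := by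
        rw [← Real.exp_add, add_neg_cancel, Real.exp_zero]
      rw [Real.cosh_eq, eq_div_iff (by positivity)]
      linear_combination hE
    rw [hch] at hD ⊢
    rw [Complex.normSq_eq_norm_sq, ← mul_pow, hm, hK, exp_re_logMobius_eq hb, norm_inv,
      Complex.norm_exp]
    have hr : (luneLog α z).re = -(stripCoord z).re := rfl
    rw [hr]
    generalize ‖1 + Real.cos β * Complex.exp (luneLog α z)‖ = N at *
    generalize Real.exp (-(stripCoord z).re) = x at *
    congr 1
    have hs := Real.sin_sq_add_cos_sq β
    have hD2 : 0 < 1 + x ^ 2 + 2 * x * Real.cos β * Real.cos (lunePhase α z) := by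
      have := mul_pos hD (show 0 < 2 * x by positivity)
      rw [add_mul, div_mul_cancel₀ _ (by positivity)] at this
      linarith
    -- With `x = exp (-s)`, the right side is `2 x (cosh s + cos β cos ψ)`.
    have hN : N ^ 2 + Real.sin β ^ 2 * x ^ 2 =
        1 + x ^ 2 + 2 * x * Real.cos β * Real.cos (lunePhase α z) := by
      linear_combination hn + x ^ 2 * hs
    rw [← mul_div_assoc]
    trans 2 * Real.sin β * x / (N ^ 2 + Real.sin β ^ 2 * x ^ 2)
    · field_simp
    · rw [hN]
      field_simp
  rw [← hKm, Complex.normSq_apply]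
  simp only [Complex.mul_re, Complex.mul_im]
  ring

lemma hasInnerAngle_one {α β : ℝ} (hα : 0 < α) (hβ : β ∈ Set.Ioo 0 Real.pi)
    (h : Real.cos β * Real.sin (Real.pi * α) = 0) : HasInnerAngle (bigonMetric α β) 1 α := by
  have hσ := Real.sin_pos_of_mem_Ioo hβ
  refine ⟨hα, 2 * Real.arctan (Real.sin β / 2), ?_, ?_, polarDomain α β, isOpen_polarDomain α β,
    Or.inl (Metric.mem_ball_self (by norm_num)), polarChart α β, polarChartInv α β,
    contDiffOn_polarChart hβ, contDiffOn_polarChartInv hα hβ h, mapsTo_polarChart hα hβ h,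
    mapsTo_polarChartInv hα hβ h, invOn_polarChart hα hβ h,
    fun z hz v w => bigonMetric_eq_polar hβ hz v w, tendsto_polarChart hβ⟩
  · have : 0 < Real.arctan (Real.sin β / 2) := Real.arctan_pos.2 (by positivity)
    linarith
  · linarith [Real.arctan_lt_pi_div_two (Real.sin β / 2)]

/-! ### Reflection and the vertex `-1` -/

/-- The reflection of the disc that exchanges the two vertices. -/
def reflection : ℂ ≃L[ℝ] ℂ := Complex.conjCLE.trans (ContinuousLinearEquiv.neg ℝ)

lemma reflection_apply (z : ℂ) : reflection z = -(starRingEnd ℂ) z := rfl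

lemma reflection_reflection (z : ℂ) : reflection (reflection z) = z := by
  simp [reflection_apply]

lemma reflection_mem_puncturedDisc {z : ℂ} : reflection z ∈ puncturedDisc ↔ z ∈ puncturedDisc := by
  have h : ∀ z ∈ puncturedDisc, reflection z ∈ puncturedDisc := by
    intro z hz
    obtain ⟨h0, h1, h2⟩ := mem_puncturedDisc.1 hz
    rw [mem_puncturedDisc, reflection_apply]
    refine ⟨by simpa using h0, fun h => h2 ?_, fun h => h1 ?_⟩
    · rw [← Complex.conj_conj z, ← neg_neg ((starRingEnd ℂ) z), h]
      simp
    · rw [← Complex.conj_conj z, ← neg_neg ((starRingEnd ℂ) z), h]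
      simp
  exact ⟨fun hz => by simpa [reflection_reflection] using h _ hz, h z⟩

lemma HasInnerAngle.reflection {g : Tensor} {x : ℂ} {θ : ℝ} (hg : HasInnerAngle g x θ)
    (hinv : ∀ z ∈ puncturedDisc, ∀ v w : ℂ,
      g (reflection z) (reflection v) (reflection w) = g z v w) :
    HasInnerAngle g (SphericalBigon.reflection x) θ := by
  obtain ⟨hθ, r, hr, hr', U, hU, hxU, Φ, Ψ, hΦ, hΨ, hm, hm', hi, hmet, ht⟩ := hg
  have hset : (SphericalBigon.reflection ⁻¹' U) ∩ puncturedDisc =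
      SphericalBigon.reflection ⁻¹' (U ∩ puncturedDisc) := by
    ext z
    simp [reflection_mem_puncturedDisc]
  refine ⟨hθ, r, hr, hr', SphericalBigon.reflection ⁻¹' U,
    hU.preimage SphericalBigon.reflection.continuous, ?_, Φ ∘ SphericalBigon.reflection,
    SphericalBigon.reflection ∘ Ψ, ?_, ?_, ?_, ?_, ?_, ?_, ?_⟩
  · simpa [reflection_reflection] using hxU
  · rw [hset]
    exact hΦ.comp_continuousLinearMap (SphericalBigon.reflection : ℂ →L[ℝ] ℂ)
  · exact SphericalBigon.reflection.contDiff.comp_contDiffOn hΨ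
  · rw [hset]
    exact fun z hz => hm hz
  · rw [hset]
    intro y hy
    simpa [reflection_reflection] using hm' hy
  · rw [hset]
    refine ⟨fun z hz => ?_, fun y hy => ?_⟩
    · simp [hi.1 hz, reflection_reflection]
    · simp [hi.2 hy, reflection_reflection]
  · intro z hz v w
    have hu := uniqueDiffWithinAt_inter_puncturedDisc
      (hU.preimage SphericalBigon.reflection.continuous) hz
    rw [hset] at hz hu ⊢
    have hd := SphericalBigon.reflection.comp_right_fderivWithin (f := Φ)
      (s := U ∩ puncturedDisc) (x := z) hu
    rw [hd, ← hinv z (reflection_mem_puncturedDisc.1 hz.2), hmet _ hz]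
    rfl
  · rw [hset]
    refine ht.comp (tendsto_nhdsWithin_iff.2 ⟨?_, ?_⟩)
    · have := SphericalBigon.reflection.continuous.tendsto (SphericalBigon.reflection x)
      rw [reflection_reflection] at this
      exact this.mono_left nhdsWithin_le_nhds
    · exact self_mem_nhdsWithin

lemma stripCoord_reflection {z : ℂ} (hz : z ∈ coordDomain) :
    stripCoord (reflection z) = -(starRingEnd ℂ) (stripCoord z) := by
  have h : (1 + reflection z) / (1 - reflection z) = (starRingEnd ℂ) ((1 + z) / (1 - z))⁻¹ := by
    rw [inv_div, reflection_apply]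
    simp [sub_eq_add_neg]
  have ha := Complex.slitPlane_arg_ne_pi hz.2
  have hi : ((1 + z) / (1 - z))⁻¹.arg ≠ Real.pi := by
    rw [Complex.arg_inv, if_neg ha]
    intro h
    linarith [Complex.neg_pi_lt_arg ((1 + z) / (1 - z))]
  rw [stripCoord, h, Complex.log_conj _ hi, Complex.log_inv _ ha, stripCoord, map_neg]

/-- The reflection acts on the strip by `s ↦ -s` with `ψ` fixed, and the metric is even in `s`. -/
lemma bigonMetric_reflection (α β : ℝ) {z : ℂ} (hz : z ∈ coordDomain) (v w : ℂ) :
    bigonMetric α β (reflection z) (reflection v) (reflection w) = bigonMetric α β z v w := by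
  have h : ∀ v, 2 / (1 - reflection z ^ 2) * reflection v =
      -(starRingEnd ℂ) (2 / (1 - z ^ 2) * v) := by
    intro v
    rw [reflection_apply, reflection_apply, neg_sq, map_mul, map_div₀, map_sub, map_pow, map_one,
      map_ofNat, mul_neg]
  have hre : ∀ v, dRe (reflection z) (reflection v) = -dRe z v := by
    intro v
    rw [dRe_apply, h, Complex.neg_re, Complex.conj_re, dRe_apply]
  have him : ∀ v, dIm (reflection z) (reflection v) = dIm z v := by
    intro v
    rw [dIm_apply, h, Complex.neg_im, Complex.conj_im, neg_neg, dIm_apply]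
  simp [bigonMetric_apply, lunePhase, stripCoord_reflection hz, hre, him]

lemma isSphericalBigon_bigonMetric {α β : ℝ} (hα : 0 < α) (hβ : β ∈ Set.Ioo 0 Real.pi)
    (h : Real.cos β * Real.sin (Real.pi * α) = 0) : IsSphericalBigon (bigonMetric α β) α α where
  smooth := (contDiffOn_bigonMetric α hβ).mono puncturedDisc_subset_coordDomain
  symm z _ v w := by
    rw [bigonMetric_apply, bigonMetric_apply]
    ring
  pos z hz v hv := bigonMetric_pos hα hβ (puncturedDisc_subset_coordDomain hz) hv
  spherical p hp := isLocallySphericalAt_bigonMetric hβ h hp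
  angle_one := hasInnerAngle_one hα hβ h
  angle_neg_one := by
    have := (hasInnerAngle_one hα hβ h).reflection fun z hz v w =>
      bigonMetric_reflection α β (puncturedDisc_subset_coordDomain hz) v w
    simpa [reflection_apply] using this

/-! ### Lengths of the edges -/

lemma lintegral_Ioo_of_hasDerivAt {F f : ℝ → ℝ} {a b : ℝ} (hab : a ≤ b)
    (hF : ∀ t ∈ Set.Icc a b, HasDerivAt F (f t) t) (hf : ContinuousOn f (Set.Icc a b))
    (h0 : ∀ t ∈ Set.Icc a b, 0 ≤ f t) :
    ∫⁻ t in Set.Ioo a b, ENNReal.ofReal (f t) = ENNReal.ofReal (F b - F a) := by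
  have hi : IntervalIntegrable f MeasureTheory.volume a b :=
    ContinuousOn.intervalIntegrable (by rwa [Set.uIcc_of_le hab])
  have hio : MeasureTheory.IntegrableOn f (Set.Ioo a b) :=
    (hf.integrableOn_Icc).mono_set Set.Ioo_subset_Icc_self
  rw [← intervalIntegral.integral_eq_sub_of_hasDerivAt (by rwa [Set.uIcc_of_le hab]) hi,
    intervalIntegral.integral_of_le hab, MeasureTheory.integral_Ioc_eq_integral_Ioo,
    MeasureTheory.ofReal_integral_eq_lintegral_ofReal hio]
  filter_upwards [MeasureTheory.ae_restrict_mem measurableSet_Ioo] with t ht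
  exact h0 t (Set.Ioo_subset_Icc_self ht)

lemma one_add_mul_cos_pos {c : ℝ} (hc : |c| < 1) (u : ℝ) : 0 < 1 + c * Real.cos u := by
  have h := one_sub_abs_le_conformalDenom c 0 u
  rw [Real.cosh_zero] at h
  linarith

/-- The half-angle substitution. At `u = ±π / 2` the primitive takes the values `±β`, so an edge has
length `2 β`. -/
lemma hasDerivAt_two_arctan_mul_tan {β : ℝ} (hβ : β ∈ Set.Ioo 0 Real.pi) {u : ℝ}
    (hu : u ∈ Set.Icc (-(Real.pi / 2)) (Real.pi / 2)) :
    HasDerivAt (fun u => 2 * Real.arctan (Real.tan (β / 2) * Real.tan (u / 2)))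
      (Real.sin β / (1 + Real.cos β * Real.cos u)) u := by
  have hπ := Real.pi_pos
  have hcx : 0 < Real.cos (u / 2) :=
    Real.cos_pos_of_mem_Ioo ⟨by linarith [hu.1], by linarith [hu.2]⟩
  have hC : 0 < Real.cos (β / 2) :=
    Real.cos_pos_of_mem_Ioo ⟨by linarith [hβ.1], by linarith [hβ.2]⟩
  have h1 : HasDerivAt (fun u : ℝ => Real.tan (u / 2)) (1 / Real.cos (u / 2) ^ 2 * (1 / 2)) u :=
    HasDerivAt.comp (h := fun u : ℝ => u / 2) u (Real.hasDerivAt_tan hcx.ne')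
      ((hasDerivAt_id' u).div_const 2)
  refine (((h1.const_mul (Real.tan (β / 2))).arctan).const_mul 2).congr_deriv ?_
  have hpos := one_add_mul_cos_pos (abs_cos_lt_one hβ) u
  have e1 := Real.sin_sq_add_cos_sq (β / 2)
  have e2 := Real.sin_sq_add_cos_sq (u / 2)
  have s1 : Real.sin β = 2 * Real.sin (β / 2) * Real.cos (β / 2) := by
    rw [← Real.sin_two_mul]
    ring_nf
  have c1 : Real.cos β = 2 * Real.cos (β / 2) ^ 2 - 1 := by
    rw [← Real.cos_two_mul]
    ring_nf
  have c2 : Real.cos u = 2 * Real.cos (u / 2) ^ 2 - 1 := by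
    rw [← Real.cos_two_mul]
    ring_nf
  have hden : 1 + Real.cos β * Real.cos u =
      2 * (Real.cos (β / 2) ^ 2 * Real.cos (u / 2) ^ 2 +
        Real.sin (β / 2) ^ 2 * Real.sin (u / 2) ^ 2) := by
    rw [c1, c2]
    linear_combination (-2 * Real.sin (u / 2) ^ 2) * e1 +
      (2 * Real.cos (β / 2) ^ 2 - 2) * e2
  rw [hden] at hpos ⊢
  rw [Real.tan_eq_sin_div_cos, Real.tan_eq_sin_div_cos, s1]
  field_simp

lemma lintegral_edge {β : ℝ} (hβ : β ∈ Set.Ioo 0 Real.pi) (a : ℝ) :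
    ∫⁻ t in Set.Ioo a (a + Real.pi), ENNReal.ofReal
      (Real.sin β / (1 + Real.cos β * Real.cos (t - a - Real.pi / 2))) =
      ENNReal.ofReal (2 * β) := by
  have hπ := Real.pi_pos
  have hpos := one_add_mul_cos_pos (abs_cos_lt_one hβ)
  rw [lintegral_Ioo_of_hasDerivAt (F := fun t => 2 * Real.arctan (Real.tan (β / 2) *
    Real.tan ((t - a - Real.pi / 2) / 2))) (by linarith)]
  · have h1 : (a + Real.pi - a - Real.pi / 2) / 2 = Real.pi / 4 := by ring
    have h2 : (a - a - Real.pi / 2) / 2 = -(Real.pi / 4) := by ring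
    rw [h1, h2, Real.tan_neg, Real.tan_pi_div_four, mul_neg, mul_one, Real.arctan_neg,
      Real.arctan_tan (by linarith [hβ.1]) (by linarith [hβ.2])]
    ring_nf
  · intro t ht
    have h := hasDerivAt_two_arctan_mul_tan hβ (u := t - a - Real.pi / 2)
      ⟨by linarith [ht.1], by linarith [ht.2]⟩
    have h' := h.comp t (((hasDerivAt_id' t).sub_const a).sub_const (Real.pi / 2))
    rw [mul_one] at h'
    exact h'
  · exact ContinuousOn.div (by fun_prop) (by fun_prop) fun t _ => (hpos _).ne'
  · exact fun t _ => div_nonneg (Real.sin_pos_of_mem_Ioo hβ).le (hpos _).le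

lemma sqrt_bigonMetric_circle {α β : ℝ} (hβ : β ∈ Set.Ioo 0 Real.pi) {t : ℝ}
    (ht : Real.sin t ≠ 0) :
    Real.sqrt (bigonMetric α β (Complex.exp (t * Complex.I))
      (deriv (fun t : ℝ => Complex.exp (t * Complex.I)) t)
      (deriv (fun t : ℝ => Complex.exp (t * Complex.I)) t)) =
    Real.sin β / (1 + Real.cos β * Real.cos (lunePhase α (Complex.exp (t * Complex.I))) *
      |Real.sin t|) := by
  have hσ := Real.sin_pos_of_mem_Ioo hβ
  have hs : 0 < |Real.sin t| := abs_pos.2 ht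
  have hderiv : deriv (fun t : ℝ => Complex.exp (t * Complex.I)) t =
      Complex.exp (t * Complex.I) * Complex.I := by
    have h1 : HasDerivAt (fun t : ℝ => (t : ℂ) * Complex.I) Complex.I t := by
      simpa using (Complex.ofRealCLM.hasDerivAt (x := t)).mul_const Complex.I
    exact h1.cexp.deriv
  set z := Complex.exp (t * Complex.I) with hz
  have hnorm : ‖z‖ = 1 := Complex.norm_exp_ofReal_mul_I t
  have him : z.im = Real.sin t := Complex.exp_ofReal_mul_I_im t
  have hd : z ∈ coordDomain := by
    apply puncturedDisc_subset_coordDomain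
    rw [mem_puncturedDisc]
    refine ⟨hnorm.le, ?_, ?_⟩ <;> intro h <;> apply ht <;> rw [← him, h] <;> simp
  have hsq : 1 - z ^ 2 = -2 * Real.sin t * Complex.I * z := by
    have hzz : z = Real.cos t + Real.sin t * Complex.I := by
      rw [hz, Complex.exp_mul_I, Complex.ofReal_cos, Complex.ofReal_sin]
    have e : (Real.sin t : ℂ) ^ 2 + (Real.cos t : ℂ) ^ 2 = 1 := by
      exact_mod_cast Real.sin_sq_add_cos_sq t
    rw [hzz]
    linear_combination -e + (Real.sin t : ℂ) ^ 2 * Complex.I_sq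
  have hz0 : z ≠ 0 := Complex.exp_ne_zero _
  -- The velocity is real in the strip coordinate because edges are horizontal lines there; only
  -- `dRe` contributes.
  have hdv : 2 / (1 - z ^ 2) * (z * Complex.I) = ((-(Real.sin t)⁻¹ : ℝ) : ℂ) := by
    have hts : (Real.sin t : ℂ) ≠ 0 := Complex.ofReal_ne_zero.2 ht
    have hI := Complex.I_ne_zero
    rw [hsq]
    push_cast at hts ⊢
    field_simp
  have hch : Real.cosh (stripCoord z).re = 1 / |Real.sin t| := by
    rw [cosh_re_stripCoord hd, hnorm, hsq]
    simp only [norm_mul, norm_neg, Complex.norm_I, hnorm, Complex.norm_real, Real.norm_eq_abs]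
    norm_num
    field_simp
  have hD := conformalDenom_pos hβ (stripCoord z).re (lunePhase α z)
  rw [bigonMetric_apply, dRe_apply, dIm_apply, hderiv, hdv, Complex.ofReal_re, Complex.ofReal_im]
  rw [hch] at hD ⊢
  have hD2 : 0 < 1 + Real.cos β * Real.cos (lunePhase α z) * |Real.sin t| := by
    have := mul_pos hD hs
    rw [add_mul, one_div, inv_mul_cancel₀ hs.ne'] at this
    exact this
  rw [show -(Real.sin t)⁻¹ * -(Real.sin t)⁻¹ = (|Real.sin t|⁻¹) ^ 2 by
    rw [inv_pow, sq_abs]; field_simp, mul_zero, mul_zero, add_zero, ← mul_pow,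
    Real.sqrt_sq (by positivity)]
  field_simp

lemma upperEdgeLength_bigonMetric (α : ℝ) {β : ℝ} (hβ : β ∈ Set.Ioo 0 Real.pi) :
    upperEdgeLength (bigonMetric α β) = ENNReal.ofReal (2 * β) := by
  rw [← lintegral_edge hβ 0, zero_add]
  refine MeasureTheory.setLIntegral_congr_fun measurableSet_Ioo fun t ht => ?_
  have hs := Real.sin_pos_of_mem_Ioo ht
  have hψ := (lunePhase_of_norm_eq_one α (Complex.norm_exp_ofReal_mul_I t)).1
    (by rwa [Complex.exp_ofReal_mul_I_im])
  simp only
  rw [sqrt_bigonMetric_circle hβ hs.ne', hψ, Real.cos_zero, mul_one, abs_of_pos hs, sub_zero,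
    Real.cos_sub_pi_div_two]

/-- On the lower edge `cos ψ` is the constant `cos (π α)`, so the integrand is that of an upper edge
with `cos β` replaced by `cos β cos (π α)`. -/
lemma lowerEdgeLength_bigonMetric {α β β' : ℝ} (hβ : β ∈ Set.Ioo 0 Real.pi)
    (hβ' : β' ∈ Set.Ioo 0 Real.pi) (hs : Real.sin β' = Real.sin β)
    (hc : Real.cos β' = Real.cos β * Real.cos (Real.pi * α)) :
    lowerEdgeLength (bigonMetric α β) = ENNReal.ofReal (2 * β') := by
  rw [← lintegral_edge hβ' Real.pi, ← two_mul]
  refine MeasureTheory.setLIntegral_congr_fun measurableSet_Ioo fun t ht => ?_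
  have hs' : Real.sin t < 0 := by
    have := Real.sin_pos_of_mem_Ioo (x := t - Real.pi) ⟨by linarith [ht.1], by linarith [ht.2]⟩
    rw [Real.sin_sub_pi] at this
    linarith
  have hψ := (lunePhase_of_norm_eq_one α (Complex.norm_exp_ofReal_mul_I t)).2
    (by rwa [Complex.exp_ofReal_mul_I_im])
  simp only
  rw [sqrt_bigonMetric_circle hβ hs'.ne, hψ, abs_of_neg hs', Real.cos_sub_pi_div_two,
    Real.sin_sub_pi, hs, hc]

/-! ### Distance between the vertices of the lune -/

lemma bigonMetric_pi_div_two_apply (α : ℝ) (z v : ℂ) :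
    bigonMetric α (Real.pi / 2) z v v =
      (1 / Real.cosh (stripCoord z).re) ^ 2 * (dRe z v ^ 2 + α ^ 2 * dIm z v ^ 2) := by
  rw [bigonMetric_apply, Real.sin_pi_div_two, Real.cos_pi_div_two]
  ring

lemma curveLength_diameter (α : ℝ) :
    curveLength (bigonMetric α (Real.pi / 2)) (fun t : ℝ => ((1 - 2 * t : ℝ) : ℂ)) 0 1 =
      ENNReal.ofReal Real.pi := by
  have h : ∫⁻ t in Set.Ioo (0 : ℝ) 1, ENNReal.ofReal (4 / (1 + (1 - 2 * t) ^ 2)) =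
      ENNReal.ofReal Real.pi := by
    have h0 : ∀ t : ℝ, 0 < 1 + (1 - 2 * t) ^ 2 := fun t => by positivity
    rw [lintegral_Ioo_of_hasDerivAt (F := fun t => -2 * Real.arctan (1 - 2 * t)) zero_le_one]
    · norm_num [Real.arctan_neg]
      ring_nf
    · intro t _
      refine ((((hasDerivAt_id' t).const_mul 2).const_sub 1).arctan.const_mul (-2)).congr_deriv ?_
      have := h0 t
      field_simp
      ring
    · exact ContinuousOn.div (by fun_prop) (by fun_prop) fun t _ => (h0 t).ne'
    · exact fun t _ => div_nonneg (by norm_num) (h0 t).le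
  rw [← h]
  refine MeasureTheory.setLIntegral_congr_fun measurableSet_Ioo fun t ht => ?_
  have hderiv : deriv (fun t : ℝ => ((1 - 2 * t : ℝ) : ℂ)) t = ((-2 : ℝ) : ℂ) := by
    have h1 : HasDerivAt (fun t : ℝ => (1 - 2 * t : ℝ)) (-2) t := by
      simpa using ((hasDerivAt_id' t).const_mul 2).const_sub 1
    exact h1.ofReal_comp.deriv
  simp only
  rw [hderiv]
  have hx : |1 - 2 * t| < 1 := abs_lt.2 ⟨by linarith [ht.2], by linarith [ht.1]⟩
  generalize 1 - 2 * t = x at *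
  have hx2 : 0 < 1 - x ^ 2 := by
    have := sq_lt_one_iff_abs_lt_one x |>.2 hx
    linarith
  have hd : (x : ℂ) ∈ coordDomain := by
    apply puncturedDisc_subset_coordDomain
    rw [mem_puncturedDisc, Complex.norm_real]
    refine ⟨hx.le, ?_, ?_⟩
    · exact_mod_cast (abs_lt.1 hx).2.ne
    · exact_mod_cast (abs_lt.1 hx).1.ne'
  have hdv : 2 / (1 - (x : ℂ) ^ 2) * ((-2 : ℝ) : ℂ) = ((-4 / (1 - x ^ 2) : ℝ) : ℂ) := by
    push_cast
    ring
  have hch : Real.cosh (stripCoord x).re = (1 + x ^ 2) / (1 - x ^ 2) := by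
    rw [cosh_re_stripCoord hd, Complex.norm_real, Real.norm_eq_abs, sq_abs]
    congr 1
    rw [show (1 - (x : ℂ) ^ 2) = ((1 - x ^ 2 : ℝ) : ℂ) by push_cast; rfl, Complex.norm_real,
      Real.norm_of_nonneg hx2.le]
  rw [bigonMetric_pi_div_two_apply, dRe_apply, dIm_apply, hdv, Complex.ofReal_re,
    Complex.ofReal_im, hch]
  congr 1
  rw [Real.sqrt_eq_iff_mul_self_eq (by positivity) (by positivity)]
  field_simp
  ring

/-- The distance from the vertex `1` in the metric `bigonMetric α (π / 2)`. -/
def vertexRadius (z : ℂ) : ℝ := 2 * Real.arctan (Real.exp (-(stripCoord z).re))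

lemma hasFDerivAt_vertexRadius {z : ℂ} (hz : z ∈ coordDomain) :
    HasFDerivAt vertexRadius (-(1 / Real.cosh (stripCoord z).re) • dRe z) z := by
  refine ((hasFDerivAt_re_stripCoord hz).fun_neg.exp.arctan.const_mul 2).congr_fderiv ?_
  have h : 1 / Real.cosh (stripCoord z).re = 2 * (1 / (1 + Real.exp (-(stripCoord z).re) ^ 2) *
      Real.exp (-(stripCoord z).re)) := by
    have h1 := Real.exp_pos (-(stripCoord z).re)
    have hE : Real.exp (stripCoord z).re * Real.exp (-(stripCoord z).re) = 1 := by
      rw [← Real.exp_add, add_neg_cancel, Real.exp_zero]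
    have h2 := Real.exp_pos (stripCoord z).re
    rw [Real.cosh_eq]
    field_simp
    linear_combination -hE
  rw [h]
  module

/-- The metric is `dρ² + sin² ρ dψ²`, so dropping the angular term shows that `ρ` is 1-Lipschitz. -/
lemma abs_fderiv_vertexRadius_le (α : ℝ) {z : ℂ} (v : ℂ) :
    |(-(1 / Real.cosh (stripCoord z).re) • dRe z) v| ≤
      Real.sqrt (bigonMetric α (Real.pi / 2) z v v) := by
  apply Real.abs_le_sqrt
  rw [bigonMetric_pi_div_two_apply, FunLike.coe_smul, Pi.smul_apply, smul_eq_mul, mul_pow, neg_sq]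
  gcongr
  nlinarith [sq_nonneg (α * dIm z v)]

/-- This expression extends continuously to the vertex `1`; the one in `vertexRadius_eq_sub` extends
to `-1`. -/
lemma vertexRadius_eq {z : ℂ} (hz : z ∈ coordDomain) :
    vertexRadius z = 2 * Real.arctan (‖1 - z‖ / ‖1 + z‖) := by
  rw [vertexRadius, Real.exp_neg, exp_re_stripCoord hz, inv_div]

lemma vertexRadius_eq_sub {z : ℂ} (hz : z ∈ coordDomain) :
    vertexRadius z = Real.pi - 2 * Real.arctan (‖1 + z‖ / ‖1 - z‖) := by
  rw [vertexRadius, Real.exp_neg, Real.arctan_inv_of_pos (Real.exp_pos _), exp_re_stripCoord hz]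
  ring

lemma pi_le_curveLength (α : ℝ) {γ : ℝ → ℂ} (hc : ContinuousOn γ (Set.Icc 0 1))
    (hd : ContDiffOn ℝ 1 γ (Set.Ioo 0 1)) (h0 : γ 0 = 1) (h1 : γ 1 = -1)
    (hm : ∀ t ∈ Set.Ioo (0 : ℝ) 1, γ t ∈ puncturedDisc) :
    ENNReal.ofReal Real.pi ≤ curveLength (bigonMetric α (Real.pi / 2)) γ 0 1 := by
  have hm' : ∀ t ∈ Set.Ioo (0 : ℝ) 1, γ t ∈ coordDomain :=
    fun t ht => puncturedDisc_subset_coordDomain (hm t ht)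
  have hrad : ContDiffOn ℝ 1 vertexRadius coordDomain :=
    (contDiffOn_const.mul (contDiffOn_re_stripCoord.neg.exp).arctan).of_le (by simp)
  have hcomp : ContDiffOn ℝ 1 (vertexRadius ∘ γ) (Set.Ioo 0 1) := hrad.comp hd hm'
  -- The curve is differentiable only on the open interval, so the estimate is made on `[x, 1 - x]`
  -- and `x` tends to `0` afterwards.
  have hle : ∀ x ∈ Set.Ioo (0 : ℝ) (1 / 2), ENNReal.ofReal (vertexRadius (γ (1 - x)) -
      vertexRadius (γ x)) ≤ curveLength (bigonMetric α (Real.pi / 2)) γ 0 1 := by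
    intro x hx
    have hsub : Set.Icc x (1 - x) ⊆ Set.Ioo 0 1 := fun t ht =>
      ⟨by linarith [hx.1, ht.1], by linarith [hx.1, ht.2]⟩
    calc ENNReal.ofReal (vertexRadius (γ (1 - x)) - vertexRadius (γ x))
        ≤ ‖(vertexRadius ∘ γ) (1 - x) - (vertexRadius ∘ γ) x‖ₑ := Real.ofReal_le_enorm _
      _ ≤ ∫⁻ t in Set.Icc x (1 - x), ‖deriv (vertexRadius ∘ γ) t‖ₑ :=
          enorm_sub_le_lintegral_deriv_of_contDiffOn_Icc (hcomp.mono hsub) (by linarith [hx.2])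
      _ ≤ ∫⁻ t in Set.Ioo 0 1, ‖deriv (vertexRadius ∘ γ) t‖ₑ :=
          MeasureTheory.lintegral_mono_set hsub
      _ ≤ curveLength (bigonMetric α (Real.pi / 2)) γ 0 1 := by
          refine MeasureTheory.setLIntegral_mono' measurableSet_Ioo fun t ht => ?_
          have hγ : HasDerivAt γ (deriv γ t) t :=
            ((hd.contDiffAt (isOpen_Ioo.mem_nhds ht)).differentiableAt (by simp)).hasDerivAt
          rw [((hasFDerivAt_vertexRadius (hm' t ht)).comp_hasDerivAt t hγ).deriv,
            ← ofReal_norm, Real.norm_eq_abs]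
          exact ENNReal.ofReal_le_ofReal (abs_fderiv_vertexRadius_le α _)
  have hev : ∀ᶠ x : ℝ in 𝓝[>] 0, x ∈ Set.Ioo (0 : ℝ) (1 / 2) :=
    Ioo_mem_nhdsGT (by norm_num)
  have hγ0 : Filter.Tendsto γ (𝓝[>] 0) (𝓝 1) := by
    rw [← h0]
    exact ((hc 0 (by simp)).mono Set.Ioo_subset_Icc_self).tendsto.mono_left
      (nhdsWithin_Ioo_eq_nhdsGT (zero_lt_one (α := ℝ))).ge
  have hγ1 : Filter.Tendsto (fun x => γ (1 - x)) (𝓝[>] 0) (𝓝 (-1)) := by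
    rw [← h1]
    refine ((hc 1 (by simp)).tendsto).comp (tendsto_nhdsWithin_iff.2 ⟨?_, ?_⟩)
    · have : Filter.Tendsto (fun x : ℝ => 1 - x) (𝓝 0) (𝓝 (1 - 0)) :=
        tendsto_const_nhds.sub Filter.tendsto_id
      rw [sub_zero] at this
      exact this.mono_left nhdsWithin_le_nhds
    · filter_upwards [hev] with x hx
      exact ⟨by linarith [hx.2], by linarith [hx.1]⟩
  have hr0 : Filter.Tendsto (fun x => vertexRadius (γ x)) (𝓝[>] 0) (𝓝 0) := by
    have hcont : ContinuousAt (fun z : ℂ => 2 * Real.arctan (‖1 - z‖ / ‖1 + z‖)) 1 := by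
      have h2 : ‖(1 : ℂ) + 1‖ ≠ 0 := by norm_num
      fun_prop (disch := assumption)
    have := hcont.tendsto.comp hγ0
    simp only [sub_self, norm_zero, zero_div, Real.arctan_zero, mul_zero] at this
    refine this.congr' ?_
    filter_upwards [hev] with x hx
    exact (vertexRadius_eq (hm' x ⟨hx.1, by linarith [hx.2]⟩)).symm
  have hr1 : Filter.Tendsto (fun x => vertexRadius (γ (1 - x))) (𝓝[>] 0) (𝓝 Real.pi) := by
    have hcont : ContinuousAt
        (fun z : ℂ => Real.pi - 2 * Real.arctan (‖1 + z‖ / ‖1 - z‖)) (-1) := by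
      have h2 : ‖(1 : ℂ) - -1‖ ≠ 0 := by norm_num
      fun_prop (disch := assumption)
    have := hcont.tendsto.comp hγ1
    simp only [add_neg_cancel, norm_zero, zero_div, Real.arctan_zero, mul_zero, sub_zero] at this
    refine this.congr' ?_
    filter_upwards [hev] with x hx
    exact (vertexRadius_eq_sub (hm' (1 - x) ⟨by linarith [hx.2], by linarith [hx.1]⟩)).symm
  have hlim := ENNReal.tendsto_ofReal (hr1.sub hr0)
  rw [sub_zero] at hlim
  exact le_of_tendsto hlim (hev.mono hle)

lemma vertexDist_bigonMetric (α : ℝ) :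
    vertexDist (bigonMetric α (Real.pi / 2)) = ENNReal.ofReal Real.pi := by
  apply le_antisymm
  · refine (iInf₂_le (fun t : ℝ => ((1 - 2 * t : ℝ) : ℂ)) ⟨?_, ?_, by simp, by norm_num, ?_⟩).trans
      (curveLength_diameter α).le
    · fun_prop
    · have h : ContDiff ℝ 1 fun t : ℝ => 1 - 2 * t := by fun_prop
      exact (Complex.ofRealCLM.contDiff.comp h).contDiffOn
    · intro t ht
      beta_reduce
      rw [mem_puncturedDisc, Complex.norm_real, Real.norm_eq_abs]
      refine ⟨abs_le.2 ⟨by linarith [ht.2], by linarith [ht.1]⟩, ?_, ?_⟩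
      · exact_mod_cast (show 1 - 2 * t < 1 by linarith [ht.1]).ne
      · exact_mod_cast (show -1 < 1 - 2 * t by linarith [ht.2]).ne'
  · exact le_iInf₂ fun γ hγ => pi_le_curveLength α hγ.1 hγ.2.1 hγ.2.2.1 hγ.2.2.2.1 hγ.2.2.2.2

/-! ### Continuity of the families -/

/-- For `β = π / 2` the conformal factor `1 / cosh² s` does not involve `α`; only the coefficient
`α²` of the angular term varies. -/
lemma isContinuousFamilyOn_angle :
    IsContinuousFamilyOn ({ν : ℝ × ℝ | 0 < ν.1} ∩ {ν | ν.1 = ν.2})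
      fun ν => bigonMetric ν.1 (Real.pi / 2) := by
  rintro ν ⟨hν, -⟩ ε hε
  have hν' : 0 < ν.1 := hν
  have h1 : ∀ᶠ μ : ℝ × ℝ in 𝓝 ν, (1 - ε) * ν.1 ^ 2 < μ.1 ^ 2 := by
    refine ContinuousAt.eventually_lt continuousAt_const (by fun_prop) ?_
    nlinarith [mul_pos hε (pow_pos hν' 2)]
  have h2 : ∀ᶠ μ : ℝ × ℝ in 𝓝 ν, μ.1 ^ 2 < (1 + ε) * ν.1 ^ 2 := by
    refine ContinuousAt.eventually_lt (by fun_prop) continuousAt_const ?_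
    nlinarith [mul_pos hε (pow_pos hν' 2)]
  filter_upwards [nhdsWithin_le_nhds h1, nhdsWithin_le_nhds h2] with μ hμ1 hμ2 z _ v
  simp only [bigonMetric_pi_div_two_apply]
  have hk := sq_nonneg (1 / Real.cosh (stripCoord z).re)
  have ha := mul_nonneg hε.le (sq_nonneg (dRe z v))
  have hb := sq_nonneg (dIm z v)
  constructor
  · rw [mul_left_comm]
    refine mul_le_mul_of_nonneg_left ?_ hk
    nlinarith [mul_le_mul_of_nonneg_right hμ1.le hb]
  · rw [mul_left_comm (1 + ε)]
    refine mul_le_mul_of_nonneg_left ?_ hk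
    nlinarith [mul_le_mul_of_nonneg_right hμ2.le hb]

lemma div_sq_bounds {σ σ' D D' η ε : ℝ} (hD : 0 < D) (hD' : 0 < D')
    (hη1 : η < 1) (h1 : D' ≤ (1 + η) * D) (h2 : (1 - η) * D ≤ D')
    (hl : (1 - ε) * (σ ^ 2 * (1 + η) ^ 2) ≤ σ' ^ 2)
    (hu : σ' ^ 2 ≤ (1 + ε) * (σ ^ 2 * (1 - η) ^ 2)) (hε : 0 < ε) :
    (1 - ε) * (σ / D) ^ 2 ≤ (σ' / D') ^ 2 ∧ (σ' / D') ^ 2 ≤ (1 + ε) * (σ / D) ^ 2 := by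
  rw [div_pow, div_pow, ← mul_div_assoc, ← mul_div_assoc,
    div_le_div_iff₀ (by positivity) (by positivity), div_le_div_iff₀ (by positivity) (by positivity)]
  have hsq1 : D' ^ 2 ≤ (1 + η) ^ 2 * D ^ 2 := by
    rw [← mul_pow]
    exact pow_le_pow_left₀ hD'.le h1 2
  have hsq2 : (1 - η) ^ 2 * D ^ 2 ≤ D' ^ 2 := by
    rw [← mul_pow]
    exact pow_le_pow_left₀ (mul_nonneg (by linarith) hD.le) h2 2
  constructor
  -- Since `ε` may exceed `1`, the lower bound may have a nonpositive factor and is then trivial.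
  · rcases le_total 0 (1 - ε) with h | h
    · calc (1 - ε) * σ ^ 2 * D' ^ 2 ≤ (1 - ε) * σ ^ 2 * ((1 + η) ^ 2 * D ^ 2) := by gcongr
        _ = (1 - ε) * (σ ^ 2 * (1 + η) ^ 2) * D ^ 2 := by ring
        _ ≤ σ' ^ 2 * D ^ 2 := by gcongr
    · calc (1 - ε) * σ ^ 2 * D' ^ 2 ≤ 0 := by
            rw [mul_assoc]
            exact mul_nonpos_of_nonpos_of_nonneg h (by positivity)
        _ ≤ σ' ^ 2 * D ^ 2 := by positivity
  · calc σ' ^ 2 * D ^ 2 ≤ (1 + ε) * (σ ^ 2 * (1 - η) ^ 2) * D ^ 2 := by gcongr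
      _ = (1 + ε) * σ ^ 2 * ((1 - η) ^ 2 * D ^ 2) := by ring
      _ ≤ (1 + ε) * σ ^ 2 * D' ^ 2 := by gcongr

/-- The denominators for `m` and `ℓ` differ by at most `|cos (m / 2) - cos (ℓ / 2)|`, while the one
for `ℓ` is at least `1 - |cos (ℓ / 2)|`. Their quotient `η m` bounds the relative change uniformly
on the disc and vanishes at `m = ℓ`. -/
lemma isContinuousFamilyOn_length (α : ℝ) :
    IsContinuousFamilyOn (Set.Ioo 0 (2 * Real.pi)) fun ℓ => bigonMetric α (ℓ / 2) := by
  intro ℓ hℓ ε hε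
  have hβ : ∀ m ∈ Set.Ioo 0 (2 * Real.pi), m / 2 ∈ Set.Ioo 0 Real.pi := fun m hm =>
    ⟨by linarith [hm.1], by linarith [hm.2]⟩
  have hc : 0 < 1 - |Real.cos (ℓ / 2)| := sub_pos.2 (abs_cos_lt_one (hβ ℓ hℓ))
  have hσ : 0 < Real.sin (ℓ / 2) ^ 2 := pow_pos (Real.sin_pos_of_mem_Ioo (hβ ℓ hℓ)) 2
  set η : ℝ → ℝ := fun m =>
    |Real.cos (m / 2) - Real.cos (ℓ / 2)| / (1 - |Real.cos (ℓ / 2)|) with hη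
  have hηc : Continuous η := by fun_prop
  have hη0 : η ℓ = 0 := by simp [hη]
  have e1 : ∀ᶠ m in 𝓝 ℓ, η m < 1 :=
    ContinuousAt.eventually_lt (by fun_prop) continuousAt_const (by rw [hη0]; norm_num)
  have e2 : ∀ᶠ m in 𝓝 ℓ,
      (1 - ε) * (Real.sin (ℓ / 2) ^ 2 * (1 + η m) ^ 2) < Real.sin (m / 2) ^ 2 := by
    refine ContinuousAt.eventually_lt (by fun_prop) (by fun_prop) ?_
    rw [hη0]
    nlinarith [mul_pos hε hσ]
  have e3 : ∀ᶠ m in 𝓝 ℓ,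
      Real.sin (m / 2) ^ 2 < (1 + ε) * (Real.sin (ℓ / 2) ^ 2 * (1 - η m) ^ 2) := by
    refine ContinuousAt.eventually_lt (by fun_prop) (by fun_prop) ?_
    rw [hη0]
    nlinarith [mul_pos hε hσ]
  filter_upwards [nhdsWithin_le_nhds e1, nhdsWithin_le_nhds e2, nhdsWithin_le_nhds e3,
    self_mem_nhdsWithin] with m h1 h2 h3 hm z _ v
  simp only [bigonMetric_apply]
  have hD := conformalDenom_pos (hβ ℓ hℓ) (stripCoord z).re (lunePhase α z)
  have hD' := conformalDenom_pos (hβ m hm) (stripCoord z).re (lunePhase α z)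
  have hDc := one_sub_abs_le_conformalDenom (Real.cos (ℓ / 2)) (stripCoord z).re (lunePhase α z)
  have hdiff : |(Real.cos (m / 2) - Real.cos (ℓ / 2)) * Real.cos (lunePhase α z)| ≤
      η m * (Real.cosh (stripCoord z).re + Real.cos (ℓ / 2) * Real.cos (lunePhase α z)) := by
    rw [abs_mul]
    calc _ ≤ |Real.cos (m / 2) - Real.cos (ℓ / 2)| :=
          mul_le_of_le_one_right (abs_nonneg _) (Real.abs_cos_le_one _)
      _ = η m * (1 - |Real.cos (ℓ / 2)|) := by
          rw [hη]
          field_simp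
      _ ≤ _ := mul_le_mul_of_nonneg_left hDc (by positivity)
  obtain ⟨hd1, hd2⟩ := abs_le.1 hdiff
  obtain ⟨k1, k2⟩ := div_sq_bounds hD hD' h1 (by linarith) (by linarith) h2.le h3.le hε
  have hq : 0 ≤ dRe z v * dRe z v + α ^ 2 * (dIm z v * dIm z v) := by
    have := mul_self_nonneg (dRe z v)
    have := mul_self_nonneg (dIm z v)
    positivity
  constructor
  · rw [← mul_assoc]
    exact mul_le_mul_of_nonneg_right k1 hq
  · rw [← mul_assoc (1 + ε)]
    exact mul_le_mul_of_nonneg_right k2 hq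

lemma isAngleDeformable_bigonMetric {α : ℝ} (hα : 0 < α) :
    IsAngleDeformable (bigonMetric α (Real.pi / 2)) (α, α) := by
  have hπ := Real.pi_pos
  refine ⟨{ν | 0 < ν.1}, (isOpen_lt continuous_const continuous_fst).mem_nhds hα,
    fun ν => bigonMetric ν.1 (Real.pi / 2), isContinuousFamilyOn_angle, ?_, fun _ _ => rfl⟩
  rintro ν ⟨hν, hν'⟩
  have hν2 : ν.1 = ν.2 := hν'
  rw [← hν2]
  exact isSphericalBigon_bigonMetric hν ⟨by linarith, by linarith⟩ (by simp)

end SphericalBigon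

end

theorem mainTheorem9 :
    (∀ α : ℝ, 0 < α →
      ∃ g : SphericalBigon.Tensor,
        SphericalBigon.IsSphericalBigon g α α ∧
        SphericalBigon.vertexDist g = ENNReal.ofReal Real.pi ∧
        SphericalBigon.IsAngleDeformable g (α, α)) ∧
    (∀ d : ℕ, 0 < d →
      ∃ B : ℝ → SphericalBigon.Tensor,
        SphericalBigon.IsContinuousFamilyOn (Set.Ioo 0 (2 * Real.pi)) B ∧
        ∀ ℓ ∈ Set.Ioo 0 (2 * Real.pi),
          SphericalBigon.IsSphericalBigon (B ℓ) d d ∧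
          (Odd d →
            SphericalBigon.upperEdgeLength (B ℓ) = ENNReal.ofReal ℓ ∧
            SphericalBigon.lowerEdgeLength (B ℓ) = ENNReal.ofReal (2 * Real.pi - ℓ)) ∧
          (Even d →
            SphericalBigon.upperEdgeLength (B ℓ) = ENNReal.ofReal ℓ ∧
            SphericalBigon.lowerEdgeLength (B ℓ) = ENNReal.ofReal ℓ)) := by
  open SphericalBigon in
  have hπ := Real.pi_pos
  refine ⟨fun α hα => ⟨bigonMetric α (Real.pi / 2), isSphericalBigon_bigonMetric hα
    ⟨by linarith, by linarith⟩ (by simp), vertexDist_bigonMetric α,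
    isAngleDeformable_bigonMetric hα⟩, fun d hd => ⟨fun ℓ => bigonMetric d (ℓ / 2),
    isContinuousFamilyOn_length d, fun ℓ hℓ => ?_⟩⟩
  have hβ : ℓ / 2 ∈ Set.Ioo 0 Real.pi := ⟨by linarith [hℓ.1], by linarith [hℓ.2]⟩
  have hup : upperEdgeLength (bigonMetric d (ℓ / 2)) = ENNReal.ofReal ℓ := by
    rw [upperEdgeLength_bigonMetric _ hβ, mul_div_cancel₀ _ two_ne_zero]
  refine ⟨isSphericalBigon_bigonMetric (by exact_mod_cast hd) hβ ?_,
    fun hodd => ⟨hup, ?_⟩, fun heven => ⟨hup, ?_⟩⟩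
  · rw [mul_comm Real.pi, Real.sin_nat_mul_pi, mul_zero]
  -- For odd `d`, `cos (π d) = -1` changes the sign of `cos β`, which replaces `β` by `π - β`.
  · rw [lowerEdgeLength_bigonMetric (β' := Real.pi - ℓ / 2) hβ
      ⟨by linarith [hβ.2], by linarith [hβ.1]⟩ (Real.sin_pi_sub _)]
    · ring_nf
    · rw [mul_comm Real.pi, Real.cos_nat_mul_pi, hodd.neg_one_pow, Real.cos_pi_sub, mul_neg_one]
  · rw [lowerEdgeLength_bigonMetric (β' := ℓ / 2) hβ hβ rfl]
    · rw [mul_div_cancel₀ _ two_ne_zero]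
    · rw [mul_comm Real.pi, Real.cos_nat_mul_pi, heven.neg_one_pow, mul_one]
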